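/- Let $A\in\mathbb{C}^{n\times n}$, put $\Re(A)=\frac12(A+A^*)$, $\Im(A)=\frac1{2i}(A-A^*)$, and let $f_A=\det\big(tI_n+x\,\Re(A)+y\,\Im(A)\big)\in\mathbb{R}[t,x,y]$ be the Kippenhahn polynomial of $A$. Assume that $f_A$ is not a power of a linear form. Let $f=f_A^{\rm red}$ be the square-free part of $f_A$ (the product of its distinct irreducible factors), let $I\subset\mathbb{R}[t,x,y,a,b]$ be the ideal generated by $f$, by $t+ax+by$ and by the $2\times2$ minors of $$\begin{pmatrix}1&a&b\\ \partial f/\partial t&\partial f/\partial x&\partial f/\partial y\end{pmatrix},$$ and let $J=\sqrt{(I:\langle t,x,y\rangle^\infty)\cap\mathbb{R}[a,b]}$. For $1\le k\le n$ let $$\Lambda_k(A)=\{\mu\in\mathbb{C}:\ PAP=\mu P\text{ for some rank-}k\text{ orthogonal projection }P\in\mathbb{C}^{n\times n}\}$$ be the rank-$k$ numerical range of $A$, and let $\partial\Lambda_k(A)$ be its topological boundary in $\mathbb{C}$. Theorem (generalized Kippenhahn theorem). (1) The ideal $J$ is principal; let $g_A\in\mathbb{R}[a,b]$ be a generator of it.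 (2) For all $1\le k\le n$ and all $a,b\in\mathbb{R}$ with $a+ib\in\partial\Lambda_k(A)$, one has $g_A(a,b)=0$. (3) For all $1\le k\le n$ and all $a,b\in\mathbb{R}$ with $a+ib\in\partial\Lambda_k(A)$, the point $[1:a:b]$ lies on the dual curve $\{[\nabla f(p)] : p\in\mathbb{P}^2(\mathbb{C}),\ f(p)=0,\ \nabla f(p)\neq0\}$ of the Kippenhahn curve, or $p_0+p_1a+p_2b=0$ for some singular point $[p_0:p_1:p_2]\in\mathbb{P}^2(\mathbb{C})$ of it, that is, a point with $f(p)=0$ and $\nabla f(p)=0$. -/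

import Mathlib

open scoped LinearAlgebra.Projectivization ComplexStarModule

noncomputable section

namespace Kippenhahn

/-! ### Higher-rank numerical ranges -/

/-- The rank-`k` numerical range `Λ_k(A)`: the complex numbers `μ` such that `P A P = μ P` for some
rank-`k` orthogonal projection `P`. -/
def higherRankNumericalRange {n : ℕ} (k : ℕ) (A : Matrix (Fin n) (Fin n) ℂ) : Set ℂ :=
  {μ | ∃ P : Matrix (Fin n) (Fin n) ℂ, IsStarProjection P ∧ P.rank = k ∧ P * A * P = μ • P}

/-! ### The Kippenhahn polynomial -/

/-- The matrix pencil `t I + x Re(A) + y Im(A)` with `(t, x, y) = (X 0, X 1, X 2)`, where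
`Re(A) = (A + A*) / 2` and `Im(A) = (A - A*) / (2 i)`. -/
def pencil {n : ℕ} (A : Matrix (Fin n) (Fin n) ℂ) :
    Matrix (Fin n) (Fin n) (MvPolynomial (Fin 3) ℂ) :=
  (MvPolynomial.X 0 : MvPolynomial (Fin 3) ℂ) • (1 : Matrix (Fin n) (Fin n) _)
    + (MvPolynomial.X 1 : MvPolynomial (Fin 3) ℂ) •
        (ℜ A : Matrix (Fin n) (Fin n) ℂ).map MvPolynomial.C
    + (MvPolynomial.X 2 : MvPolynomial (Fin 3) ℂ) •
        (ℑ A : Matrix (Fin n) (Fin n) ℂ).map MvPolynomial.C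

/-- Entrywise conjugation of the coefficients transposes the pencil. -/
theorem pencil_map_conj {n : ℕ} (A : Matrix (Fin n) (Fin n) ℂ) :
    (pencil A).map (MvPolynomial.map (starRingEnd ℂ)) = (pencil A).transpose := by
  have hH : ∀ H : selfAdjoint (Matrix (Fin n) (Fin n) ℂ), ∀ i j,
      (starRingEnd ℂ) ((H : Matrix (Fin n) (Fin n) ℂ) i j) = (H : Matrix (Fin n) (Fin n) ℂ) j i := by
    intro H i j
    have h : star (H : Matrix (Fin n) (Fin n) ℂ) = H := selfAdjoint.mem_iff.mp H.2
    exact congrFun (congrFun h j) i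
  ext1 i j
  simp [pencil, Matrix.one_apply, hH, eq_comm, apply_ite]

/-- The determinant of the pencil has real coefficients. -/
theorem exists_real_det_pencil {n : ℕ} (A : Matrix (Fin n) (Fin n) ℂ) :
    ∃ f : MvPolynomial (Fin 3) ℝ, MvPolynomial.map (algebraMap ℝ ℂ) f = (pencil A).det := by
  have h : MvPolynomial.map (starRingEnd ℂ) (pencil A).det = (pencil A).det := by
    rw [RingHom.map_det, RingHom.mapMatrix_apply, pencil_map_conj, Matrix.det_transpose]
  have h2 : (pencil A).det ∈ Set.range (MvPolynomial.map (σ := Fin 3) (algebraMap ℝ ℂ)) := by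
    rw [MvPolynomial.mem_range_map_iff_coeffs_subset]
    intro c hc
    obtain ⟨m, -, rfl⟩ := MvPolynomial.mem_coeffs_iff.mp hc
    have h3 := congrArg (MvPolynomial.coeff m) h
    rw [MvPolynomial.coeff_map, Complex.conj_eq_iff_real] at h3
    obtain ⟨r, hr⟩ := h3
    exact ⟨r, hr.symm⟩
  exact h2

/-- The Kippenhahn polynomial `f_A = det (t I + x Re(A) + y Im(A))`, as an element of
`ℝ[t, x, y]`. -/
def kippenhahnPoly {n : ℕ} (A : Matrix (Fin n) (Fin n) ℂ) : MvPolynomial (Fin 3) ℝ :=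
  (exists_real_det_pencil A).choose

theorem map_kippenhahnPoly {n : ℕ} (A : Matrix (Fin n) (Fin n) ℂ) :
    MvPolynomial.map (algebraMap ℝ ℂ) (kippenhahnPoly A) = (pencil A).det :=
  (exists_real_det_pencil A).choose_spec

/-- `f` is a power of a linear form. -/
def IsPowerOfLinearForm (f : MvPolynomial (Fin 3) ℝ) : Prop :=
  ∃ (l : MvPolynomial (Fin 3) ℝ) (m : ℕ), l.IsHomogeneous 1 ∧ f = l ^ m

/-! ### Plane projective curves, their singular points and their duals -/

/-- The square-free part `f^red` of `f`: the product of the distinct irreducible factors of `f`,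
one representative being chosen in each class of associated elements. -/
def squarefreePart (f : MvPolynomial (Fin 3) ℝ) : MvPolynomial (Fin 3) ℝ :=
  letI : StrongNormalizationMonoid (MvPolynomial (Fin 3) ℝ) :=
    UniqueFactorizationMonoid.strongNormalizationMonoid
  UniqueFactorizationMonoid.radical f

/-- The gradient of `f` at a complex point `v`. -/
def gradientAt (f : MvPolynomial (Fin 3) ℝ) (v : Fin 3 → ℂ) : Fin 3 → ℂ :=
  fun i => MvPolynomial.aeval v (MvPolynomial.pderiv i f)

/-- The set `Sing(f)` of singular points in `ℙ²(ℂ)` of the curve `f = 0`, for homogeneous `f`: the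
points where `f^red` and its gradient vanish. -/
def singularPoints (f : MvPolynomial (Fin 3) ℝ) : Set (ℙ ℂ (Fin 3 → ℂ)) :=
  {p | MvPolynomial.aeval p.rep (squarefreePart f) = 0 ∧ gradientAt (squarefreePart f) p.rep = 0}

/-- The dual variety in `ℙ²(ℂ)` of the curve `f = 0`, for homogeneous `f`: the image of the set of
nonsingular points under `p ↦ [∇ f^red (p)]`. -/
def dualVariety (f : MvPolynomial (Fin 3) ℝ) : Set (ℙ ℂ (Fin 3 → ℂ)) :=
  {q | ∃ p : ℙ ℂ (Fin 3 → ℂ), MvPolynomial.aeval p.rep (squarefreePart f) = 0 ∧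
    ∃ h : gradientAt (squarefreePart f) p.rep ≠ 0,
      q = Projectivization.mk ℂ (gradientAt (squarefreePart f) p.rep) h}

/-- The point `[1 : a : b]` of `ℙ²(ℂ)`. -/
def affinePoint (a b : ℂ) : ℙ ℂ (Fin 3 → ℂ) :=
  Projectivization.mk ℂ ![1, a, b] (fun h => one_ne_zero (congrFun h 0))

/-- The affine line `p₀ + p₁ a + p₂ b = 0` dual to the point `p = [p₀ : p₁ : p₂]`. -/
def dualLine (p : ℙ ℂ (Fin 3 → ℂ)) : Set (ℂ × ℂ) :=
  {z | p.rep 0 + p.rep 1 * z.1 + p.rep 2 * z.2 = 0}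

/-! ### The ideal whose generator is `g_A`

In `MvPolynomial (Fin 3 ⊕ Fin 2) ℝ` the variables `t, x, y` are `X (Sum.inl 0)`, `X (Sum.inl 1)`,
`X (Sum.inl 2)`, and the variables `a, b` are `X (Sum.inr 0)`, `X (Sum.inr 1)`. -/

/-- The row vector `(1, a, b)`. -/
def dualRow : Fin 3 → MvPolynomial (Fin 3 ⊕ Fin 2) ℝ :=
  ![1, MvPolynomial.X (Sum.inr 0), MvPolynomial.X (Sum.inr 1)]

/-- The `2 × 3` matrix with rows `(1, a, b)` and `(∂f/∂t, ∂f/∂x, ∂f/∂y)`. -/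
def tangencyMatrix (f : MvPolynomial (Fin 3) ℝ) :
    Matrix (Fin 2) (Fin 3) (MvPolynomial (Fin 3 ⊕ Fin 2) ℝ) :=
  Matrix.of ![dualRow, fun i => MvPolynomial.rename Sum.inl (MvPolynomial.pderiv i f)]

/-- The ideal of `ℝ[t, x, y, a, b]` generated by `f`, by `t + a x + b y` and by the `2 × 2` minors
of the tangency matrix of `f`. -/
def conormalIdeal (f : MvPolynomial (Fin 3) ℝ) : Ideal (MvPolynomial (Fin 3 ⊕ Fin 2) ℝ) :=
  Ideal.span {MvPolynomial.rename Sum.inl f, ∑ i, dualRow i * MvPolynomial.X (Sum.inl i)} ⊔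
    Ideal.span (Set.range fun c : Fin 3 × Fin 3 =>
      ((tangencyMatrix f).submatrix id ![c.1, c.2]).det)

/-- The irrelevant ideal `⟨t, x, y⟩` of `ℝ[t, x, y, a, b]`. -/
def irrelevantIdeal : Ideal (MvPolynomial (Fin 3 ⊕ Fin 2) ℝ) :=
  Ideal.span (Set.range fun i : Fin 3 => MvPolynomial.X (Sum.inl i))

/-- The saturation `I : 𝔪^∞`, the union of the increasing sequence of ideals `I : 𝔪^N`. -/
def saturation {R : Type*} [CommRing R] (I m : Ideal R) : Ideal R :=
  ⨆ N : ℕ, Submodule.colon I ((m ^ N : Ideal R) : Set R)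

/-- The ideal `J` of `ℝ[a, b]` attached to `f_A`: form the ideal of `f_A^red` above, saturate it by
`⟨t, x, y⟩`, eliminate `t, x, y` and take the radical. -/
def boundaryIdeal {n : ℕ} (A : Matrix (Fin n) (Fin n) ℂ) : Ideal (MvPolynomial (Fin 2) ℝ) :=
  (Ideal.comap (MvPolynomial.rename (R := ℝ) (Sum.inr : Fin 2 → Fin 3 ⊕ Fin 2))
    (saturation (conormalIdeal (squarefreePart (kippenhahnPoly A))) irrelevantIdeal)).radical

/-- `g` is (a choice of) the polynomial `g_A`, that is, a generator of the ideal `J`. -/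
def IsBoundaryPoly {n : ℕ} (A : Matrix (Fin n) (Fin n) ℂ) (g : MvPolynomial (Fin 2) ℝ) : Prop :=
  boundaryIdeal A = Ideal.span {g}

end Kippenhahn

end

noncomputable section

namespace Kippenhahn

open Finset Matrix

/-! ### Isotropic families of real diagonal pencils -/

/-! Write `H`, `K` for the Hermitian parts of `A` and let `z = a + ib` be a boundary point of
`Λ_k(A)`. Compactness of the set of rank-`k` projections makes `Λ_k(A)` closed, so `H - a` and `K -
b` vanish on a common `k`-dimensional subspace. Since `z` is not interior, the strict Li–Sze theorem
(`zero_mem_of_forall_hasPosSubspace`) yields a direction `(c, s) ≠ 0` in which `c(H - a) + s(K - b)`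
is positive definite on no `k`-dimensional subspace.

Combinations in nearby directions are nonnegative on the isotropic subspace, so each has an
eigenvalue between `0` and a multiple of the distance to `(c, s)`. These eigenvalues give points of
the Kippenhahn curve near `p = (-(ac + bs), c, s)`, all displaced to the same side of the line `t +
ax + by = 0`. A first-order expansion at `p` then forces `∇f(p)` to be a multiple of `(1, a, b)`
(`exists_tangent_point`). If the gradient is nonzero, `[1 : a : b]` is a dual point; otherwise `p`
is singular and lies on the line. In both cases every element of `J` vanishes at `(a, b)`.

The Li–Sze theorem comes from a canonical form. Rotate so that `H` has the least positive index
among all directions, and perturb so that `H` is invertible and `H⁻¹K` has distinct eigenvalues. In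
an eigenbasis, pairs of conjugate eigenvalues contribute isotropic basis vectors. The real
eigenvalues carry signs, and minimality of the index becomes a ballot-type condition on them;
cutting the resulting lattice walk by height gives alternating blocks, on each of which the nodal
weights of Lagrange interpolation produce isotropic vectors (`exists_isotropic_diagonal`).

Principality of `J` is elimination by one resultant: on `t = -(ax + by)` the tangency conditions are
two binary forms in `x, y`, and `J` is the radical of the ideal of their resultant
(`radical_comap_saturation_eq`). In a UFD the radical of a principal ideal is principal. -/

/-- The sum of the signs `δ i` over the indices `i ∈ R` with `μ i < s`. -/
def signSumBelow {ι : Type*} (R : Finset ι) (μ : ι → ℝ) (δ : ι → ℤ) (s : ℝ) : ℤ :=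
  ∑ i ∈ R with μ i < s, δ i

/-- The height of the edge of the walk with steps `δ`, ordered by `μ`, that is crossed at `j`. -/
def edgeHeight {ι : Type*} (R : Finset ι) (μ : ι → ℝ) (δ : ι → ℤ) (j : ι) : ℤ :=
  min (signSumBelow R μ δ (μ j)) (signSumBelow R μ δ (μ j) + δ j)

theorem edgeHeight_congr {ι : Type*} {R F : Finset ι} {μ : ι → ℝ} {δ : ι → ℤ} {j : ι}
    (h : ∀ i, μ i < μ j → (i ∈ F ↔ i ∈ R)) : edgeHeight F μ δ j = edgeHeight R μ δ j := by
  have : signSumBelow F μ δ (μ j) = signSumBelow R μ δ (μ j) := by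
    unfold signSumBelow
    refine sum_congr ?_ fun _ _ => rfl
    ext i
    simp only [mem_filter]
    exact ⟨fun hi => ⟨(h i hi.2).1 hi.1, hi.2⟩, fun hi => ⟨(h i hi.2).2 hi.1, hi.2⟩⟩
  simp [edgeHeight, this]

/-- The signs on a given edge of the walk telescope. -/
theorem sum_edge {ι : Type*} (F : Finset ι) (μ : ι → ℝ) (δ : ι → ℤ)
    (hμ : Set.InjOn μ F) (hδ : ∀ i ∈ F, δ i = 1 ∨ δ i = -1) (h : ℤ) :
    ∑ i ∈ F with edgeHeight F μ δ i = h, δ i =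
      (if h < ∑ i ∈ F, δ i then 1 else 0) - (if h < 0 then 1 else 0) := by
  classical
  -- Append the last step of the walk: earlier edges keep their heights, and the new edge starts at
  -- the height reached so far.
  induction F using Finset.induction_on_max_value μ with
  | empty => simp only [filter_empty, sum_empty]; exact (sub_self _).symm
  | insert a s ha hmax ih =>
    have hlt : ∀ x ∈ s, μ x < μ a := fun x hx => lt_of_le_of_ne (hmax x hx) fun he =>
      ha (hμ (by simp [hx]) (by simp) he ▸ hx)
    have ih := ih (hμ.mono (by simp)) fun i hi => hδ i (by simp [hi])
    have h1 : ∀ i ∈ s, edgeHeight (insert a s) μ δ i = edgeHeight s μ δ i := fun i hi =>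
      edgeHeight_congr fun k hk => by
        have : k ≠ a := by rintro rfl; exact absurd (hlt i hi) hk.not_gt
        simp [this]
    have h2 : signSumBelow (insert a s) μ δ (μ a) = ∑ i ∈ s, δ i := by
      unfold signSumBelow
      refine sum_congr ?_ fun _ _ => rfl
      ext i
      simp only [mem_filter, mem_insert]
      constructor
      · rintro ⟨rfl | h, h'⟩
        · exact absurd h' (lt_irrefl _)
        · exact h
      · exact fun h => ⟨Or.inr h, hlt i h⟩
    have h3 : edgeHeight (insert a s) μ δ a = min (∑ i ∈ s, δ i) (∑ i ∈ s, δ i + δ a) := by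
      rw [edgeHeight, h2]
    rw [sum_insert ha, sum_filter, sum_insert ha, ← sum_filter, h3]
    rw [show (s.filter fun i => edgeHeight (insert a s) μ δ i = h) =
      s.filter fun i => edgeHeight s μ δ i = h from filter_congr fun i hi => by rw [h1 i hi], ih]
    rcases hδ a (by simp) with h4 | h4 <;> rw [h4] <;> split_ifs <;> omega

/-- Converts the sum of the signs to the right of a node into the parity of the number of nodes
there, which is the exponent in the sign of a nodal weight. -/
theorem even_card_sub_sum_sign {ι : Type*} (F : Finset ι) (δ : ι → ℤ)
    (hδ : ∀ i ∈ F, δ i = 1 ∨ δ i = -1) : Even ((F.card : ℤ) - ∑ i ∈ F, δ i) := by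
  rw [card_eq_sum_ones, Nat.cast_sum, ← sum_sub_distrib]
  refine Finset.even_sum _ fun i hi => ?_
  rcases hδ i hi with h | h <;> rw [h] <;> decide

/-- Nodal weights annihilate polynomials of small degree. -/
theorem sum_nodalWeight_mul_eval_eq_zero {ι : Type*} [DecidableEq ι] (E : Finset ι) (μ : ι → ℝ)
    (hμ : Set.InjOn μ E) (P : Polynomial ℝ) (hP : P.natDegree + 1 < E.card) :
    ∑ i ∈ E, Lagrange.nodalWeight E μ i * P.eval (μ i) = 0 := by
  have h := Lagrange.coeff_eq_sum hμ (P := P) (lt_of_le_of_lt Polynomial.degree_le_natDegree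
    (by exact_mod_cast lt_of_le_of_lt (Nat.le_succ _) hP))
  rw [Polynomial.coeff_eq_zero_of_natDegree_lt (by omega)] at h
  rw [h]
  refine sum_congr rfl fun i _ => ?_
  rw [Lagrange.nodalWeight, prod_inv_distrib, div_eq_mul_inv, mul_comm]

/-- In the product of the `(μ j - μ i)⁻¹`, exactly the nodes to the right of `j` contribute negative
factors. -/
theorem sign_nodalWeight {ι : Type*} [DecidableEq ι] (E : Finset ι) (μ : ι → ℝ)
    (hμ : Set.InjOn μ E) {j : ι} (hj : j ∈ E) :
    0 < (-1) ^ (E.filter fun i => μ j < μ i).card * Lagrange.nodalWeight E μ j := by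
  have h1 : (E.filter fun i => μ j < μ i) = (E.erase j).filter fun i => μ j < μ i := by
    ext i
    simp only [mem_filter, mem_erase]
    exact ⟨fun h => ⟨⟨by rintro rfl; exact lt_irrefl _ h.2, h.1⟩, h.2⟩, fun h => ⟨h.1.2, h.2⟩⟩
  rw [h1, Lagrange.nodalWeight, ← prod_const, prod_filter, ← prod_mul_distrib]
  refine prod_pos fun i hi => ?_
  obtain ⟨hij, hi⟩ := mem_erase.1 hi
  split_ifs with h
  · rw [neg_one_mul, neg_pos, inv_lt_zero]; linarith
  · have : μ i ≠ μ j := fun h => hij (hμ hi hj h)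
    rw [one_mul, inv_pos, sub_pos]
    exact lt_of_le_of_ne (not_lt.1 h) this

/-- A set of nodes on which the signs of `a` alternate carries a family of vectors, one for each
positive sign, isotropic for `diag a` and for `diag (a μ)`. -/
theorem exists_isotropic_of_alternating {ι : Type*} [DecidableEq ι] (E : Finset ι) (μ a : ι → ℝ)
    (hμ : Set.InjOn μ E)
    (hsign : ∀ j ∈ E, a j * ((-1) ^ (E.filter fun i => μ j < μ i).card) < 0)
    (hcard : 2 * (E.filter fun i => 0 < a i).card < E.card) :
    ∃ u : ι → ι → ℝ, (∀ b j, j ∉ E → u b j = 0) ∧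
      (∀ b ∈ E, 0 < a b → u b b ≠ 0) ∧
      (∀ b ∈ E, 0 < a b → ∀ b' ∈ E, 0 < a b' → b ≠ b' → u b b' = 0) ∧
      ∀ b ∈ E, 0 < a b → ∀ b' ∈ E, 0 < a b' →
        ∑ j ∈ E, a j * (u b j * u b' j) = 0 ∧ ∑ j ∈ E, a j * μ j * (u b j * u b' j) = 0 := by
  -- The factor `c j` is chosen so that `a j * c j ^ 2` is minus the nodal weight; `hsign` says that
  -- the two have opposite signs.
  set c : ι → ℝ := fun j => Real.sqrt (-(Lagrange.nodalWeight E μ j / a j)) with hc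
  set B := E.filter fun i => 0 < a i with hB
  -- Isotropy becomes the vanishing of a divided difference of `P * f b * f b'`, where `P` is `1` or
  -- `X`. Its degree is at most `2 * B.card - 1`, which `hcard` makes small enough.
  set f : ι → Polynomial ℝ := fun b => ∏ i ∈ B.erase b, (Polynomial.X - Polynomial.C (μ i)) with hf
  have ha : ∀ j ∈ E, a j ≠ 0 := fun j hj h => by simpa [h] using hsign j hj
  have hpos : ∀ j ∈ E, 0 < -(Lagrange.nodalWeight E μ j / a j) := fun j hj => by
    have h1 := sign_nodalWeight E μ hμ hj
    have h2 := hsign j hj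
    have h3 : ((-1 : ℝ) ^ (E.filter fun i => μ j < μ i).card) ≠ 0 := by simp
    rw [neg_pos, ← mul_div_mul_left _ _ h3, mul_comm _ (a j)]
    exact div_neg_of_pos_of_neg h1 h2
  have hc2 : ∀ j ∈ E, a j * (c j * c j) = - Lagrange.nodalWeight E μ j := fun j hj => by
    rw [hc, Real.mul_self_sqrt (hpos j hj).le]
    field_simp [ha j hj]
  have hfd : ∀ b ∈ B, (f b).natDegree + 1 = B.card := fun b hb => by
    rw [hf, Polynomial.natDegree_prod_of_monic _ _ fun i _ => Polynomial.monic_X_sub_C _]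
    simp [card_erase_add_one hb]
  have hfz : ∀ b, ∀ b' ∈ B, b ≠ b' → (f b).eval (μ b') = 0 := fun b b' hb' hne => by
    rw [hf, Polynomial.eval_prod]
    exact prod_eq_zero (mem_erase.2 ⟨hne.symm, hb'⟩) (by simp)
  have key : ∀ b ∈ B, ∀ b' ∈ B, ∀ P : Polynomial ℝ, P.natDegree ≤ 1 →
      ∑ j ∈ E, a j * P.eval (μ j) *
        ((c j * (f b).eval (μ j)) * (c j * (f b').eval (μ j))) = 0 := by
    intro b hb b' hb' P hP
    have h1 := hfd b hb
    have h2 := hfd b' hb'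
    have h3 := sum_nodalWeight_mul_eval_eq_zero E μ hμ (P * f b * f b') (by
      have h4 := Polynomial.natDegree_mul_le (p := P * f b) (q := f b')
      have h5 := Polynomial.natDegree_mul_le (p := P) (q := f b)
      omega)
    rw [← neg_eq_zero, ← sum_neg_distrib] at h3
    rw [← h3]
    refine sum_congr rfl fun j hj => ?_
    rw [← neg_mul, ← hc2 j hj]
    simp only [Polynomial.eval_mul]
    ring
  refine ⟨fun b j => if j ∈ E then c j * (f b).eval (μ j) else 0, ?_, ?_, ?_, ?_⟩
  · intro b j hj
    simp [hj]
  · intro b hb hab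
    simp only [hb, if_true]
    refine mul_ne_zero (Real.sqrt_ne_zero'.2 (hpos b hb)) ?_
    rw [hf, Polynomial.eval_prod]
    refine prod_ne_zero_iff.2 fun i hi => ?_
    obtain ⟨h1, h2⟩ := mem_erase.1 hi
    simp only [Polynomial.eval_sub, Polynomial.eval_X, Polynomial.eval_C]
    exact sub_ne_zero.2 fun h => h1 (hμ (mem_filter.1 h2).1 hb h.symm)
  · intro b hb hab b' hb' hab' hne
    simp [hb', hfz b b' (mem_filter.2 ⟨hb', hab'⟩) hne]
  · intro b hb hab b' hb' hab'
    have h1 := key b (mem_filter.2 ⟨hb, hab⟩) b' (mem_filter.2 ⟨hb', hab'⟩) 1 (by simp)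
    have h2 := key b (mem_filter.2 ⟨hb, hab⟩) b' (mem_filter.2 ⟨hb', hab'⟩) Polynomial.X (by simp)
    constructor
    · rw [← h1]
      exact sum_congr rfl fun j hj => by simp [hj]
    · rw [← h2]
      exact sum_congr rfl fun j hj => by simp [hj]

/-- If, on each side of every real number, the negative `a i` are enough to compensate the positive
ones, then there is a family of vectors, one for each positive `a i`, isotropic for `diag a` and for
`diag (a μ)`. -/
theorem exists_isotropic_diagonal {ι : Type*} [DecidableEq ι] (R : Finset ι) (μ a : ι → ℝ)
    (hμ : Set.InjOn μ R) (ha : ∀ j ∈ R, a j ≠ 0)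
    (hle : ∀ s, (R.filter fun j => 0 < a j ∧ μ j ≤ s).card ≤
      (R.filter fun j => a j < 0 ∧ μ j < s).card)
    (hge : ∀ s, (R.filter fun j => 0 < a j ∧ s ≤ μ j).card ≤
      (R.filter fun j => a j < 0 ∧ s < μ j).card) :
    ∃ u : ι → ι → ℝ, (∀ b j, j ∉ R → u b j = 0) ∧
      (∀ b ∈ R, 0 < a b → u b b ≠ 0) ∧
      (∀ b ∈ R, 0 < a b → ∀ b' ∈ R, 0 < a b' → b ≠ b' → u b b' = 0) ∧
      ∀ b ∈ R, 0 < a b → ∀ b' ∈ R, 0 < a b' →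
        ∑ j ∈ R, a j * (u b j * u b' j) = 0 ∧ ∑ j ∈ R, a j * μ j * (u b j * u b' j) = 0 := by
  -- The walk goes up at negative `a j` and down at positive ones; `hle` and `hge` keep every edge
  -- between height `0` and the final height.
  set δ : ι → ℤ := fun j => if a j < 0 then 1 else -1 with hδ
  have hδ1 : ∀ i, δ i = 1 ∨ δ i = -1 := fun i => by simp only [hδ]; split_ifs <;> simp
  set E : ℤ → Finset ι := fun h => R.filter fun j => edgeHeight R μ δ j = h with hE
  have hsum : ∀ p : ι → Prop, ∀ [DecidablePred p], ∑ j ∈ R with p j, δ j =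
      (R.filter fun j => a j < 0 ∧ p j).card - (R.filter fun j => 0 < a j ∧ p j).card := by
    intro p _
    have h1 : ∀ j ∈ R.filter p, δ j = (if a j < 0 then 1 else 0) - (if 0 < a j then 1 else 0) := by
      intro j hj
      simp only [hδ]
      rcases lt_or_gt_of_ne (ha j (mem_filter.1 hj).1) with h | h
      · simp [h, h.not_gt]
      · simp [h, h.not_gt]
    rw [sum_congr rfl h1, sum_sub_distrib, sum_boole, sum_boole, filter_filter, filter_filter]
    simp only [and_comm]
  have hL : ∀ s, ((R.filter fun j => 0 < a j ∧ μ j = s).card : ℤ) ≤ signSumBelow R μ δ s := by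
    intro s
    rw [signSumBelow, hsum]
    have h1 := hle s
    have h2 : (R.filter fun j => 0 < a j ∧ μ j ≤ s).card =
        (R.filter fun j => 0 < a j ∧ μ j = s).card + (R.filter fun j => 0 < a j ∧ μ j < s).card := by
      rw [← card_union_of_disjoint]
      · congr 1
        ext j
        simp only [mem_filter, mem_union, le_iff_eq_or_lt]
        tauto
      · refine disjoint_filter.2 fun j _ h h' => ?_
        linarith [h.2, h'.2]
    omega
  have hU : ∀ s, ((R.filter fun j => 0 < a j ∧ μ j = s).card : ℤ) ≤ ∑ j ∈ R with s < μ j, δ j := by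
    intro s
    rw [hsum]
    have h1 := hge s
    have h2 : (R.filter fun j => 0 < a j ∧ s ≤ μ j).card =
        (R.filter fun j => 0 < a j ∧ μ j = s).card + (R.filter fun j => 0 < a j ∧ s < μ j).card := by
      rw [← card_union_of_disjoint]
      · congr 1
        ext j
        simp only [mem_filter, mem_union, le_iff_eq_or_lt, eq_comm (a := s)]
        tauto
      · refine disjoint_filter.2 fun j _ h h' => ?_
        linarith [h.2, h'.2]
    omega
  have hle1 : ∀ j ∈ R, ∑ i ∈ R with μ i ≤ μ j, δ i = signSumBelow R μ δ (μ j) + δ j := by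
    intro j hj
    have : (R.filter fun i => μ i ≤ μ j) = insert j (R.filter fun i => μ i < μ j) := by
      ext i
      simp only [mem_filter, mem_insert, le_iff_eq_or_lt]
      constructor
      · rintro ⟨h1, h2 | h2⟩
        · exact Or.inl (hμ h1 hj h2)
        · exact Or.inr ⟨h1, h2⟩
      · rintro (rfl | h)
        · exact ⟨hj, Or.inl rfl⟩
        · exact ⟨h.1, Or.inr h.2⟩
    rw [this, sum_insert (by simp), add_comm, signSumBelow]
  have hone : ∀ j ∈ R, 0 < a j → 1 ≤ (R.filter fun i => 0 < a i ∧ μ i = μ j).card :=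
    fun j hj h => card_pos.2 ⟨j, by simp [hj, h]⟩
  have hheight : ∀ j ∈ R, 0 ≤ edgeHeight R μ δ j ∧ edgeHeight R μ δ j < ∑ i ∈ R, δ i := by
    intro j hj
    have h1 := hL (μ j)
    have h2 := hU (μ j)
    have h3 := sum_filter_add_sum_filter_not R (fun i => μ i ≤ μ j) δ
    simp only [not_le] at h3
    rw [hle1 j hj] at h3
    rw [← h3, edgeHeight]
    rcases lt_or_gt_of_ne (ha j hj) with h | h
    · have h4 : δ j = 1 := by simp [hδ, h]
      rw [h4]
      omega
    · have h4 : δ j = -1 := by simp [hδ, h.not_gt]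
      have := hone j hj h
      rw [h4]
      omega
  -- A walk from `0` to its final height crosses every intermediate level once more upwards than
  -- downwards.
  have hEtot : ∀ h, ∀ j ∈ E h, ∑ i ∈ E h, δ i = 1 := by
    intro h j hj
    obtain ⟨hjR, rfl⟩ := mem_filter.1 hj
    obtain ⟨h1, h2⟩ := hheight j hjR
    rw [hE, sum_edge R μ δ hμ (fun i _ => hδ1 i), if_pos h2, if_neg h1.not_gt, sub_zero]
  have hEsum : ∀ h, ∀ j ∈ E h, ∑ i ∈ E h with μ j < μ i, δ i = if a j < 0 then 0 else 1 := by
    intro h j hjE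
    have h1 := hEtot h j hjE
    obtain ⟨hj, hjh⟩ := mem_filter.1 hjE
    have h2 := sum_filter_add_sum_filter_not (E h) (fun i => μ i ≤ μ j) δ
    simp only [not_le] at h2
    -- Stop the walk just after `j`: it ends above level `h` if `j` is an up-step and on it
    -- otherwise. Hence the crossings up to `j` sum to `1` or `0`, and those after `j` to `0` or
    -- `1`, which is alternation.
    have h3 := sum_edge (R.filter fun i => μ i ≤ μ j) μ δ (hμ.mono (filter_subset _ _))
      (fun i _ => hδ1 i) h
    have h4 : ((R.filter fun i => μ i ≤ μ j).filter fun i =>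
        edgeHeight (R.filter fun i => μ i ≤ μ j) μ δ i = h) = (E h).filter fun i => μ i ≤ μ j := by
      ext i
      simp only [hE, mem_filter]
      have : μ i ≤ μ j → edgeHeight (R.filter fun i => μ i ≤ μ j) μ δ i = edgeHeight R μ δ i :=
        fun hi => edgeHeight_congr fun k hk => by
          simp only [mem_filter, and_iff_left_iff_imp]
          exact fun _ => (hk.trans_le hi).le
      constructor
      · rintro ⟨⟨h1, h2⟩, h3⟩
        exact ⟨⟨h1, this h2 ▸ h3⟩, h2⟩
      · rintro ⟨⟨h1, h2⟩, h3⟩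
        exact ⟨⟨h1, h3⟩, this h3 ▸ h2⟩
    have h0 : ¬ h < 0 := by rw [← hjh]; exact (hheight j hj).1.not_gt
    rw [h4, hle1 j hj, if_neg h0] at h3
    rw [edgeHeight] at hjh
    by_cases ha0 : a j < 0
    · have h5 : δ j = 1 := by simp [hδ, ha0]
      rw [h5] at h3 hjh
      rw [if_pos (by omega)] at h3
      rw [if_pos ha0]
      linarith
    · have h5 : δ j = -1 := by simp [hδ, ha0]
      rw [h5] at h3 hjh
      rw [if_neg (by omega)] at h3
      rw [if_neg ha0]
      linarith
  have hER : ∀ h, E h ⊆ R := fun h => filter_subset _ _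
  have hEne : ∀ h, (E h).Nonempty → ∃ u : ι → ι → ℝ, (∀ b j, j ∉ E h → u b j = 0) ∧
      (∀ b ∈ E h, 0 < a b → u b b ≠ 0) ∧
      (∀ b ∈ E h, 0 < a b → ∀ b' ∈ E h, 0 < a b' → b ≠ b' → u b b' = 0) ∧
      ∀ b ∈ E h, 0 < a b → ∀ b' ∈ E h, 0 < a b' →
        ∑ j ∈ E h, a j * (u b j * u b' j) = 0 ∧
          ∑ j ∈ E h, a j * μ j * (u b j * u b' j) = 0 := by
    rintro h ⟨j₀, hj₀⟩
    refine exists_isotropic_of_alternating (E h) μ a (hμ.mono (hER h)) ?_ ?_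
    · intro j hj
      have h1 := hEsum h j hj
      have h2 := even_card_sub_sum_sign ((E h).filter fun i => μ j < μ i) δ fun i _ => hδ1 i
      rw [h1] at h2
      split_ifs at h2 with h3
      · rw [sub_zero, Int.even_coe_nat] at h2
        rwa [h2.neg_one_pow, mul_one]
      · have h4 : Odd ((E h).filter fun i => μ j < μ i).card := by
          rw [← Int.odd_coe_nat]
          simpa using h2.add_one
        rw [h4.neg_one_pow, mul_neg_one, neg_lt_zero]
        exact lt_of_le_of_ne (not_lt.1 h3) (ha j (hER h hj)).symm
    · have h1 := hEtot h j₀ hj₀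
      have h2 : ∀ i ∈ E h, δ i = 1 - 2 * (if 0 < a i then 1 else 0) := fun i hi => by
        rcases lt_or_gt_of_ne (ha i (hER h hi)) with h | h
        · simp [hδ, h, h.not_gt]
        · simp [hδ, h, h.not_gt]
      rw [sum_congr rfl h2, sum_sub_distrib, ← mul_sum, sum_boole, sum_const] at h1
      simp only [nsmul_eq_mul, mul_one] at h1
      omega
  choose! u hu using hEne
  -- Vectors are taken from the block of their own level; those of different levels have disjoint
  -- supports, so their products vanish termwise.
  set g : ι → ℤ := edgeHeight R μ δ with hg
  have hmem : ∀ j ∈ R, j ∈ E (g j) := fun j hj => mem_filter.2 ⟨hj, rfl⟩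
  have hmem' : ∀ j h, j ∈ E h → g j = h := fun j h hj => (mem_filter.1 hj).2
  have hu' : ∀ b ∈ R, _ := fun b hb => hu (g b) ⟨b, hmem b hb⟩
  refine ⟨fun b j => if b ∈ R then u (g b) b j else 0, ?_, ?_, ?_, ?_⟩
  · intro b j hj
    by_cases hb : b ∈ R <;> simp only [hb, if_true, if_false]
    · exact (hu' b hb).1 b j fun h => hj (hER _ h)
  · intro b hb hab
    simpa [hb] using (hu' b hb).2.1 b (hmem b hb) hab
  · intro b hb hab b' hb' hab' hne
    simp only [hb, if_true]
    by_cases h : b' ∈ E (g b)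
    · exact (hu' b hb).2.2.1 b (hmem b hb) hab b' h hab' hne
    · exact (hu' b hb).1 b b' h
  · intro b hb hab b' hb' hab'
    simp only [hb, hb', if_true]
    by_cases h : g b' = g b
    · have h0 : ∀ j ∈ R, j ∉ E (g b) → u (g b) b j * u (g b') b' j = 0 := fun j _ hj => by
        rw [(hu' b hb).1 b j hj, zero_mul]
      obtain ⟨h1, h2⟩ := (hu' b hb).2.2.2 b (hmem b hb) hab b' (h ▸ hmem b' hb') hab'
      constructor
      · rw [← sum_subset (hER (g b)) fun j hj hj' => by rw [h0 j hj hj', mul_zero], h, h1]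
      · rw [← sum_subset (hER (g b)) fun j hj hj' => by rw [h0 j hj hj', mul_zero], h, h2]
    · have h0 : ∀ j, u (g b) b j * u (g b') b' j = 0 := fun j => by
        by_cases hj : j ∈ E (g b)
        · have : j ∉ E (g b') := fun hj' => h ((hmem' j _ hj').symm.trans (hmem' j _ hj))
          rw [(hu' b' hb').1 b' j this, mul_zero]
        · rw [(hu' b hb).1 b j hj, zero_mul]
      simp [h0]

end Kippenhahn
end

noncomputable section

namespace Kippenhahn

open Finset Matrix

/-! ### Positive definite subspaces of Hermitian forms -/

/-- The form of `H` is positive definite on some subspace of dimension `d`. -/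
def HasPosSubspace {ι : Type*} [Fintype ι] (H : Matrix ι ι ℂ) (d : ℕ) : Prop :=
  ∃ L : (Fin d → ℂ) →ₗ[ℂ] (ι → ℂ), ∀ x, x ≠ 0 → 0 < (star (L x) ⬝ᵥ H *ᵥ L x).re

section HasPosSubspace

variable {ι : Type*} [Fintype ι]

theorem HasPosSubspace.of_fintype {κ : Type*} [Fintype κ] {H : Matrix ι ι ℂ}
    (L : (κ → ℂ) →ₗ[ℂ] (ι → ℂ)) (hL : ∀ x, x ≠ 0 → 0 < (star (L x) ⬝ᵥ H *ᵥ L x).re) :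
    HasPosSubspace H (Fintype.card κ) := by
  let e := LinearEquiv.funCongrLeft ℂ ℂ (Fintype.equivFin κ)
  exact ⟨L ∘ₗ e.toLinearMap, fun x hx => hL _ (by simpa using hx)⟩

/-- A positive definite subspace meets the kernel of `T` only in `0`, so `T` embeds it. This bounds
the positive index from above without eigenvalues. -/
theorem HasPosSubspace.le_finrank {H : Matrix ι ι ℂ} {d : ℕ} (h : HasPosSubspace H d)
    {M : Type*} [AddCommGroup M] [Module ℂ M] [FiniteDimensional ℂ M] (T : (ι → ℂ) →ₗ[ℂ] M)
    (hT : ∀ x, T x = 0 → (star x ⬝ᵥ H *ᵥ x).re ≤ 0) : d ≤ Module.finrank ℂ M := by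
  obtain ⟨L, hL⟩ := h
  have hinj : Function.Injective (T ∘ₗ L) := by
    rw [← LinearMap.ker_eq_bot, LinearMap.ker_eq_bot']
    intro x hx
    by_contra hne
    exact absurd (hL x hne) (hT _ hx).not_gt
  simpa using LinearMap.finrank_le_finrank_of_injective hinj

theorem HasPosSubspace.le_card_of_nonpos {H : Matrix ι ι ℂ} {d : ℕ} (h : HasPosSubspace H d)
    (Z : Finset ι) (hZ : ∀ x : ι → ℂ, (∀ j ∈ Z, x j = 0) → (star x ⬝ᵥ H *ᵥ x).re ≤ 0) :
    d ≤ Z.card := by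
  have := h.le_finrank (LinearMap.funLeft ℂ ℂ (fun j : Z => (j : ι))) fun x hx =>
    hZ x fun j hj => congrFun hx ⟨j, hj⟩
  simpa using this

theorem HasPosSubspace.mono {H H' : Matrix ι ι ℂ} {d : ℕ} (h : HasPosSubspace H d)
    (hH : ∀ x, (star x ⬝ᵥ H *ᵥ x).re ≤ (star x ⬝ᵥ H' *ᵥ x).re) : HasPosSubspace H' d :=
  let ⟨L, hL⟩ := h
  ⟨L, fun x hx => (hL x hx).trans_le (hH _)⟩

theorem HasPosSubspace.smul {H : Matrix ι ι ℂ} {d : ℕ} (h : HasPosSubspace H d) {r : ℝ}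
    (hr : 0 < r) : HasPosSubspace (r • H) d := by
  obtain ⟨L, hL⟩ := h
  refine ⟨L, fun x hx => ?_⟩
  rw [smul_mulVec, dotProduct_smul, Complex.smul_re]
  exact mul_pos hr (hL x hx)

theorem HasPosSubspace.of_le {H : Matrix ι ι ℂ} {d e : ℕ} (h : HasPosSubspace H d) (hed : e ≤ d) :
    HasPosSubspace H e := by
  obtain ⟨L, hL⟩ := h
  have hinj : Function.Injective (Fin.castLE hed) := Fin.castLE_injective hed
  refine ⟨L ∘ₗ Function.ExtendByZero.linearMap ℂ (Fin.castLE hed), fun x hx => hL _ ?_⟩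
  contrapose! hx
  ext i
  have := congrFun hx (Fin.castLE hed i)
  simpa [hinj.extend_apply] using this

theorem HasPosSubspace.of_conjTranspose_mul_mul {κ : Type*} [Fintype κ] {H : Matrix ι ι ℂ}
    {d : ℕ} (V : Matrix ι κ ℂ) (h : HasPosSubspace (Vᴴ * H * V) d) : HasPosSubspace H d := by
  obtain ⟨L, hL⟩ := h
  refine ⟨V.mulVecLin ∘ₗ L, fun x hx => ?_⟩
  have := hL x hx
  simpa [← mulVec_mulVec, dotProduct_mulVec, star_mulVec, vecMul_vecMul] using this

theorem HasPosSubspace.conjTranspose_mul_mul [DecidableEq ι] {H : Matrix ι ι ℂ}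
    {d : ℕ} {V : Matrix ι ι ℂ} (hV : IsUnit V.det) (h : HasPosSubspace H d) :
    HasPosSubspace (Vᴴ * H * V) d := by
  refine HasPosSubspace.of_conjTranspose_mul_mul V⁻¹ ?_
  convert h using 1
  have h1 : V * V⁻¹ = 1 := mul_nonsing_inv V hV
  have h2 : V⁻¹ᴴ * Vᴴ = 1 := by rw [← conjTranspose_mul, h1, conjTranspose_one]
  calc V⁻¹ᴴ * (Vᴴ * H * V) * V⁻¹ = (V⁻¹ᴴ * Vᴴ) * H * (V * V⁻¹) := by simp only [Matrix.mul_assoc]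
    _ = H := by rw [h1, h2, Matrix.one_mul, Matrix.mul_one]

/-- The same `L` serves all nearby matrices: positivity on the compact unit sphere survives a small
change of `H`, and homogeneity extends it to all nonzero vectors. -/
theorem isOpen_hasPosSubspace (d : ℕ) : IsOpen {H : Matrix ι ι ℂ | HasPosSubspace H d} := by
  rw [isOpen_iff_eventually]
  rintro H ⟨L, hL⟩
  have hK : IsCompact (Metric.sphere (0 : Fin d → ℂ) 1) := isCompact_sphere 0 1
  have hcont : Continuous fun p : Matrix ι ι ℂ × (Fin d → ℂ) =>
      (star (L p.2) ⬝ᵥ p.1 *ᵥ L p.2).re := by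
    have hLc : Continuous L := L.continuous_of_finiteDimensional
    refine Complex.continuous_re.comp (Continuous.dotProduct ?_ (Continuous.matrix_mulVec ?_ ?_)) <;>
      fun_prop
  have h1 : ∀ᶠ H' in nhds H, ∀ x ∈ Metric.sphere (0 : Fin d → ℂ) 1,
      0 < (star (L x) ⬝ᵥ H' *ᵥ L x).re := by
    refine hK.eventually_forall_of_forall_eventually fun x hx => ?_
    exact hcont.continuousAt.eventually (lt_mem_nhds (hL x fun h => by simp [h] at hx))
  filter_upwards [h1] with H' hH'
  refine ⟨L, fun x hx => ?_⟩
  have hn : ‖x‖ ≠ 0 := norm_ne_zero_iff.2 hx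
  have h2 := hH' (((‖x‖⁻¹ : ℝ) : ℂ) • x) (by
    rw [mem_sphere_zero_iff_norm, norm_smul]
    simp [hn])
  rw [map_smul, star_smul, mulVec_smul, smul_dotProduct, dotProduct_smul] at h2
  have h3 : (star ((‖x‖⁻¹ : ℝ) : ℂ)) = ((‖x‖⁻¹ : ℝ) : ℂ) := by
    simp only [RCLike.star_def, Complex.conj_ofReal]
  rw [h3, smul_smul, ← Complex.ofReal_mul, smul_eq_mul, Complex.re_ofReal_mul] at h2
  exact (mul_pos_iff_of_pos_left (by positivity)).1 h2

end HasPosSubspace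

/-! ### Pencils in diagonal form -/

/-- Let `G` be a nonsingular Hermitian matrix whose product with `diagonal μ` is Hermitian. The
partner of `i` is the index of the conjugate of `μ i`. -/
theorem exists_partner {ι : Type*} [Fintype ι] [DecidableEq ι] {G : Matrix ι ι ℂ} {μ : ι → ℂ}
    (hμ : Function.Injective μ) (hG : G.IsHermitian) (hGμ : (G * diagonal μ).IsHermitian)
    (hdet : IsUnit G.det) :
    ∃ σ : ι → ι, (∀ i, σ (σ i) = i) ∧ (∀ i, μ (σ i) = star (μ i)) ∧
      ∀ i j, G i j ≠ 0 ↔ j = σ i := by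
  -- Compare the `(i, j)` entry of `G * diagonal μ` with that of its adjoint. As `μ` is injective, a
  -- row has at most one nonzero entry, and invertibility provides one.
  have h1 : ∀ i j, G i j ≠ 0 → μ j = star (μ i) := by
    intro i j hij
    have h2 := hGμ.apply i j
    rw [mul_diagonal, mul_diagonal, star_mul', hG.apply, mul_comm, mul_comm (G i j)] at h2
    exact (mul_right_cancel₀ hij h2).symm
  have h2 : ∀ i, ∃ j, G i j ≠ 0 := by
    intro i
    by_contra! h
    exact hdet.ne_zero (det_eq_zero_of_row_eq_zero i h)
  choose σ hσ using h2
  have h3 : ∀ i, μ (σ i) = star (μ i) := fun i => h1 _ _ (hσ i)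
  refine ⟨σ, fun i => hμ (by rw [h3, h3, star_star]), h3, fun i j => ⟨fun h => ?_, ?_⟩⟩
  · exact hμ (by rw [h3, h1 _ _ h])
  · rintro rfl
    exact hσ i

end Kippenhahn
end

noncomputable section

namespace Kippenhahn

open Finset Matrix

/-- A pencil in diagonal form whose positive index is smallest at the first of the two forms has an
isotropic subspace of the dimension of that index. -/
theorem exists_isotropic_of_diagonal {ι : Type*} [Fintype ι] [DecidableEq ι] {G : Matrix ι ι ℂ}
    {μ : ι → ℂ} (hμ : Function.Injective μ) (hG : G.IsHermitian)
    (hGμ : (G * diagonal μ).IsHermitian) (hdet : IsUnit G.det) {q : ℕ}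
    (hmax : ∀ d, HasPosSubspace G d → d ≤ q)
    (hall : ∀ c s : ℝ, (c, s) ≠ 0 → HasPosSubspace (c • G + s • (G * diagonal μ)) q) :
    ∃ X : Matrix ι (Fin q) ℂ, Xᴴ * G * X = 0 ∧ Xᴴ * (G * diagonal μ) * X = 0 ∧
      LinearIndependent ℂ X.col := by
  obtain ⟨σ, hσσ, hσμ, hGσ⟩ := exists_partner hμ hG hGμ hdet
  have hG0 : ∀ i j, j ≠ σ i → G i j = 0 := fun i j h => not_not.1 fun h' => h ((hGσ i j).1 h')
  have hGn : ∀ i, G i (σ i) ≠ 0 := fun i => (hGσ i _).2 rfl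
  have hform : ∀ (D : ι → ℂ) (x y : ι → ℂ), star x ⬝ᵥ (G * diagonal D) *ᵥ y =
      ∑ j, star (x j) * G j (σ j) * D (σ j) * y (σ j) := by
    intro D x y
    rw [dotProduct]
    refine sum_congr rfl fun j _ => ?_
    rw [mulVec, dotProduct, sum_eq_single (σ j) (fun k _ hk => by simp [hG0 j k hk]) (by simp)]
    simp only [mul_diagonal, Pi.star_apply]
    ring
  have hform1 : ∀ x y : ι → ℂ, star x ⬝ᵥ G *ᵥ y = ∑ j, star (x j) * G j (σ j) * y (σ j) := by
    intro x y
    have := hform 1 x y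
    simpa using this
  set Up := univ.filter fun j => 0 < (μ j).im with hUp
  set Dn := univ.filter fun j => (μ j).im < 0 with hDn
  set R := univ.filter fun j => (μ j).im = 0 with hR
  set a : ι → ℝ := fun j => (G j j).re with ha
  set m : ι → ℝ := fun j => (μ j).re with hm
  have hσim : ∀ j, (μ (σ j)).im = -(μ j).im := fun j => by simp [hσμ]
  have hσR : ∀ j ∈ R, σ j = j := fun j hj => hμ (by
    rw [hσμ]; exact Complex.conj_eq_iff_im.2 (mem_filter.1 hj).2)
  have hμR : ∀ j ∈ R, μ j = (m j : ℂ) := fun j hj => by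
    apply Complex.ext <;> simp [hm, (mem_filter.1 hj).2]
  have hGa : ∀ j, G j j = (a j : ℂ) := fun j => (hG.coe_re_apply_self j).symm
  have ha0 : ∀ j ∈ R, a j ≠ 0 := fun j hj h => hGn j (by rw [hσR j hj, hGa, h]; simp)
  have hcardUD : Up.card = Dn.card := by
    refine card_bij' (fun j _ => σ j) (fun j _ => σ j) ?_ ?_ (fun j _ => hσσ j) fun j _ => hσσ j
    · intro j hj
      simpa [hDn, hσim] using (mem_filter.1 hj).2
    · intro j hj
      simpa [hUp, hσim] using (mem_filter.1 hj).2
  set Rp := R.filter fun j => 0 < a j with hRp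
  -- `T` will index the isotropic family: one vector for each conjugate pair and one for each real
  -- eigenvalue of positive sign. Its cardinality is shown to be the index `q`.
  set T := Up ∪ Rp with hT
  have hdisjU : ∀ p : ι → Prop, ∀ [DecidablePred p], Disjoint Dn (R.filter p) := fun p _ =>
    disjoint_left.2 fun j h h' => (mem_filter.1 h).2.ne (mem_filter.1 (mem_filter.1 h').1).2
  have hTcard : T.card = Up.card + Rp.card := card_union_of_disjoint <|
    disjoint_left.2 fun j h h' => (mem_filter.1 h).2.ne' (mem_filter.1 (mem_filter.1 h').1).2
  have htri : ∀ j, j ∈ Up ∨ j ∈ Dn ∨ j ∈ R := fun j => by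
    rcases lt_trichotomy (μ j).im 0 with h | h | h <;> simp [hUp, hDn, hR, h]
  -- forms vanishing on lower coordinates and on the positive real coordinates
  have hnonpos : ∀ c s : ℝ, ∀ x : ι → ℂ,
      (∀ j ∈ Dn ∪ R.filter fun j => 0 < a j * (c + s * m j), x j = 0) →
      (star x ⬝ᵥ (c • G + s • (G * diagonal μ)) *ᵥ x).re ≤ 0 := by
    intro c s x hx
    have h1 : c • G + s • (G * diagonal μ) = G * diagonal fun j => (c : ℂ) + s * μ j := by
      ext i j
      simp only [Matrix.add_apply, Matrix.smul_apply, mul_diagonal, Complex.real_smul]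
      ring
    rw [h1, hform, Complex.re_sum]
    refine sum_nonpos fun j _ => ?_
    rcases htri j with h | h | h
    · have : σ j ∈ Dn := by simpa [hDn, hσim] using (mem_filter.1 h).2
      simp [hx (σ j) (mem_union_left _ this)]
    · simp [hx j (mem_union_left _ h)]
    · rw [hσR j h, hμR j h, hGa]
      by_cases h2 : 0 < a j * (c + s * m j)
      · simp [hx j (mem_union_right _ (mem_filter.2 ⟨h, h2⟩))]
      · have h3 : star (x j) * (a j : ℂ) * ((c : ℂ) + s * (m j : ℂ)) * x j =
            ((a j * (c + s * m j) * Complex.normSq (x j) : ℝ) : ℂ) := by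
          have := Complex.normSq_eq_conj_mul_self (z := x j)
          push_cast
          rw [this]
          simp only [RCLike.star_def]
          ring
        rw [h3, Complex.ofReal_re]
        exact mul_nonpos_of_nonpos_of_nonneg (not_lt.1 h2) (Complex.normSq_nonneg _)
  have hqle : ∀ c s : ℝ, (c, s) ≠ 0 →
      q ≤ Dn.card + (R.filter fun j => 0 < a j * (c + s * m j)).card := by
    intro c s hcs
    rw [← card_union_of_disjoint (hdisjU _)]
    exact (hall c s hcs).le_card_of_nonpos _ (hnonpos c s)
  have hTq : T.card ≤ q := by
    -- On a conjugate pair `j ∈ Up`, `σ j ∈ Dn`, the vector with entries `y j` and `star (G j (σ j))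
    -- * y j` has form value `2 |G j (σ j)|² |y j|²`, so each pair adds one positive dimension.
    set Q : (ι → ℂ) →ₗ[ℂ] (ι → ℂ) := LinearMap.pi fun j =>
      LinearMap.proj j + (if j ∈ Dn then star (G (σ j) j) else 0) • LinearMap.proj (σ j) with hQ
    refine hmax _ ?_
    rw [← Fintype.card_coe]
    refine HasPosSubspace.of_fintype
      (Q ∘ₗ Function.ExtendByZero.linearMap ℂ (Subtype.val : T → ι)) fun x hx => ?_
    set y : ι → ℂ := Function.ExtendByZero.linearMap ℂ (Subtype.val : T → ι) x with hy
    have hyT : ∀ j, j ∉ T → y j = 0 := fun j hj =>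
      Function.extend_apply' _ _ _ fun ⟨b, hb⟩ => hj (hb ▸ b.2)
    have hyx : ∀ b : T, y b = x b := fun b => Subtype.val_injective.extend_apply _ _ _
    have hz : ∀ j, j ∉ Dn → Q y j = y j := fun j hj => by simp [hQ, hj]
    have hzD : ∀ j ∈ Dn, Q y j = star (G (σ j) j) * y (σ j) := fun j hj => by
      have : j ∉ T := fun h => by
        rcases mem_union.1 h with h | h
        · exact (mem_filter.1 h).2.not_gt (mem_filter.1 hj).2
        · exact disjoint_left.1 (hdisjU _) hj h
      simp [hQ, hj, hyT j this]
    have hDU : ∀ j ∈ Dn, σ j ∉ Dn := fun j hj => by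
      simpa [hDn, hσim] using (mem_filter.1 hj).2.le
    have hUD : ∀ j ∈ Up, σ j ∈ Dn := fun j hj => by
      simpa [hDn, hσim] using (mem_filter.1 hj).2
    have hUnD : ∀ j ∈ Up, j ∉ Dn := fun j hj h => (mem_filter.1 hj).2.not_gt (mem_filter.1 h).2
    have hRnD : ∀ j ∈ R, j ∉ Dn := fun j hj h => (mem_filter.1 h).2.ne (mem_filter.1 hj).2
    have htU : ∀ j ∈ Up, star (Q y j) * G j (σ j) * Q y (σ j) =
        ((Complex.normSq (G j (σ j)) * Complex.normSq (y j) : ℝ) : ℂ) := fun j hj => by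
      rw [hz j (hUnD j hj), hzD _ (hUD j hj), hσσ]
      push_cast
      rw [Complex.normSq_eq_conj_mul_self, Complex.normSq_eq_conj_mul_self]
      simp only [RCLike.star_def]
      ring
    have htD : ∀ j ∈ Dn, star (Q y j) * G j (σ j) * Q y (σ j) =
        ((Complex.normSq (G j (σ j)) * Complex.normSq (y (σ j)) : ℝ) : ℂ) := fun j hj => by
      rw [hzD j hj, hz _ (hDU j hj), hG.apply]
      push_cast
      rw [Complex.normSq_eq_conj_mul_self, Complex.normSq_eq_conj_mul_self, ← hG.apply j (σ j)]
      simp only [RCLike.star_def, map_mul, Complex.conj_conj]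
      ring
    have htR : ∀ j ∈ R, star (Q y j) * G j (σ j) * Q y (σ j) =
        ((a j * Complex.normSq (y j) : ℝ) : ℂ) := fun j hj => by
      rw [hσR j hj, hz _ (hRnD j hj), hGa]
      push_cast
      rw [Complex.normSq_eq_conj_mul_self]
      simp only [RCLike.star_def]
      ring
    rw [LinearMap.comp_apply, ← hy, hform1, Complex.re_sum]
    refine sum_pos' (fun j _ => ?_) ?_
    · rcases htri j with h | h | h
      · rw [htU j h, Complex.ofReal_re]
        exact mul_nonneg (Complex.normSq_nonneg _) (Complex.normSq_nonneg _)
      · rw [htD j h, Complex.ofReal_re]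
        exact mul_nonneg (Complex.normSq_nonneg _) (Complex.normSq_nonneg _)
      · rw [htR j h, Complex.ofReal_re]
        by_cases h2 : 0 < a j
        · exact mul_nonneg h2.le (Complex.normSq_nonneg _)
        · rw [hyT j fun h3 => ?_]
          · simp
          · rcases mem_union.1 h3 with h3 | h3
            · exact (mem_filter.1 h3).2.ne' (mem_filter.1 h).2
            · exact h2 (mem_filter.1 h3).2
    · obtain ⟨b, hb⟩ := Function.ne_iff.1 hx
      have hb' : 0 < Complex.normSq (y b) := Complex.normSq_pos.2 (by rw [hyx]; exact hb)
      refine ⟨b, mem_univ _, ?_⟩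
      rcases mem_union.1 b.2 with h | h
      · rw [htU b h, Complex.ofReal_re]
        exact mul_pos (Complex.normSq_pos.2 (hGn b)) hb'
      · rw [htR b (mem_filter.1 h).1, Complex.ofReal_re]
        exact mul_pos (mem_filter.1 h).2 hb'
  have hqT : T.card = q := by
    -- In the direction `(1, 0)` the bound reads `q ≤ Dn.card + Rp.card`, and conjugation matches
    -- `Dn` with `Up`.
    have := hqle 1 0 (by simp)
    simp only [zero_mul, add_zero, mul_one] at this
    refine le_antisymm hTq ?_
    rw [hTcard, hcardUD]
    exact this
  have hRple : ∀ c s : ℝ, (c, s) ≠ 0 →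
      Rp.card ≤ (R.filter fun j => 0 < a j * (c + s * m j)).card := by
    intro c s hcs
    have := hqle c s hcs
    omega
  have hsplit : ∀ p : ℝ → Prop, ∀ [DecidablePred p], Rp.card =
      (R.filter fun j => 0 < a j ∧ p (m j)).card + (R.filter fun j => 0 < a j ∧ ¬ p (m j)).card := by
    intro p _
    rw [← card_union_of_disjoint (disjoint_filter.2 fun j _ h h' => h'.2 h.2), ← filter_or]
    exact congrArg card (filter_congr fun j _ => by tauto)
  have hmul : ∀ (t : ℝ → ℝ), (R.filter fun j => 0 < a j * t (m j)).card =
      (R.filter fun j => 0 < a j ∧ 0 < t (m j)).card +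
      (R.filter fun j => a j < 0 ∧ t (m j) < 0).card := by
    intro t
    rw [← card_union_of_disjoint (disjoint_filter.2 fun j _ h h' => h.1.not_gt h'.1), ← filter_or]
    simp only [mul_pos_iff]
  obtain ⟨u, hu0, hu1, hu2, hu3⟩ := exists_isotropic_diagonal R m a
    (fun i hi j hj h => hμ (by rw [hμR i hi, hμR j hj, h])) ha0
    (by
      intro s
      -- In this direction the real coordinates have signs `a j * (m j - s)`. Cancelling the
      -- positive `a j` with `s < m j` leaves the inequality for the left of `s`; the opposite
      -- direction gives the right.
      have h1 := hRple (-s) 1 (by simp)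
      rw [hmul fun t => -s + 1 * t, hsplit fun t => s < t] at h1
      simp only [one_mul, neg_add_eq_sub, sub_pos, sub_neg, not_lt] at h1
      omega)
    (by
      intro s
      have h1 := hRple s (-1) (by simp)
      rw [hmul fun t => s + -1 * t, hsplit fun t => t < s] at h1
      simp only [neg_mul, one_mul, ← sub_eq_add_neg, sub_pos, sub_neg, not_lt] at h1
      omega)
  -- the isotropic family
  set Y : T → ι → ℂ := fun b j =>
    if (b : ι) ∈ Up then (if j = b then 1 else 0) else (u b j : ℂ) with hY
  have hYU : ∀ b : T, (b : ι) ∈ Up → ∀ j, Y b j = if j = b then 1 else 0 := fun b hb j => by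
    simp [hY, hb]
  have hYR : ∀ b : T, (b : ι) ∉ Up → ∀ j, Y b j = (u b j : ℂ) := fun b hb j => by
    simp [hY, hb]
  have hTR : ∀ b : T, (b : ι) ∉ Up → (b : ι) ∈ R ∧ 0 < a b := fun b hb => by
    have := (mem_union.1 b.2).resolve_left hb
    exact mem_filter.1 this
  have hiso : ∀ c s : ℝ, ∀ b b' : T, star (Y b) ⬝ᵥ
      (G * diagonal fun j => (c : ℂ) + s * μ j) *ᵥ Y b' = 0 := by
    intro c s b b'
    rw [hform]
    by_cases hb : (b : ι) ∈ Up
    · refine sum_eq_zero fun j _ => ?_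
      rw [hYU b hb]
      split_ifs with hj
      · have h0 : (μ (σ j)).im < 0 := by
          rw [hσim, hj, neg_lt_zero]
          exact (mem_filter.1 hb).2
        have : Y b' (σ j) = 0 := by
          by_cases hb' : (b' : ι) ∈ Up
          · rw [hYU b' hb', if_neg]
            intro h
            exact (mem_filter.1 hb').2.not_gt (h ▸ h0)
          · rw [hYR b' hb', hu0 _ _ fun h => h0.ne (mem_filter.1 h).2, Complex.ofReal_zero]
        rw [this, mul_zero]
      · simp
    · have hbR := hTR b hb
      have hterm : ∀ j, j ∉ R → star (Y b j) * G j (σ j) * ((c : ℂ) + s * μ (σ j)) *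
          Y b' (σ j) = 0 := fun j hj => by rw [hYR b hb, hu0 _ _ hj]; simp
      rw [← sum_subset (subset_univ R) fun j _ hj => hterm j hj]
      by_cases hb' : (b' : ι) ∈ Up
      · refine sum_eq_zero fun j hj => ?_
        rw [hσR j hj, hYU b' hb', if_neg, mul_zero]
        rintro rfl
        exact (mem_filter.1 hb').2.ne' (mem_filter.1 hj).2
      · have hbR' := hTR b' hb'
        obtain ⟨h1, h2⟩ := hu3 b hbR.1 hbR.2 b' hbR'.1 hbR'.2
        have h3 : c * ∑ j ∈ R, a j * (u b j * u b' j) +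
            s * ∑ j ∈ R, a j * m j * (u b j * u b' j) = 0 := by rw [h1, h2]; simp
        rw [mul_sum, mul_sum, ← sum_add_distrib] at h3
        rw [← Complex.ofReal_zero, ← h3, Complex.ofReal_sum]
        refine sum_congr rfl fun j hj => ?_
        rw [hσR j hj, hYR b hb, hYR b' hb', hGa, hμR j hj]
        simp only [RCLike.star_def, Complex.conj_ofReal]
        push_cast
        ring
  have hYdiag : ∀ b : T, Y b b ≠ 0 := fun b => by
    by_cases hb : (b : ι) ∈ Up
    · simp [hYU b hb]
    · rw [hYR b hb, Complex.ofReal_ne_zero]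
      exact hu1 b (hTR b hb).1 (hTR b hb).2
  have hYoff : ∀ b b' : T, b ≠ b' → Y b b' = 0 := fun b b' hne => by
    have hne' : (b : ι) ≠ b' := fun h => hne (Subtype.ext h)
    by_cases hb : (b : ι) ∈ Up
    · rw [hYU b hb, if_neg hne'.symm]
    · rw [hYR b hb]
      by_cases hb' : (b' : ι) ∈ Up
      · rw [hu0 _ _ fun h => (mem_filter.1 hb').2.ne' (mem_filter.1 h).2, Complex.ofReal_zero]
      · rw [hu2 b (hTR b hb).1 (hTR b hb).2 b' (hTR b' hb').1 (hTR b' hb').2 hne',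
          Complex.ofReal_zero]
  have hind : LinearIndependent ℂ Y := by
    rw [Fintype.linearIndependent_iff]
    intro g hg b
    have h1 := congrFun hg (b : ι)
    rw [Finset.sum_apply, sum_eq_single b (fun b' _ hne => by simp [hYoff b' b hne]) (by simp)] at h1
    simpa [hYdiag b] using h1
  let e : Fin q ≃ T := (T.equivFinOfCardEq hqT).symm
  refine ⟨Matrix.of fun i k => Y (e k) i, ?_, ?_, ?_⟩
  · ext k l
    have := hiso 1 0 (e k) (e l)
    simp only [Complex.ofReal_one, Complex.ofReal_zero, zero_mul, add_zero] at this
    rw [show (diagonal fun _ => 1 : Matrix ι ι ℂ) = 1 from rfl, Matrix.mul_one] at this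
    rw [Matrix.mul_assoc]
    exact this
  · ext k l
    have := hiso 0 1 (e k) (e l)
    simp only [Complex.ofReal_one, Complex.ofReal_zero, one_mul, zero_add] at this
    rw [Matrix.mul_assoc]
    exact this
  · exact hind.comp e e.injective

end Kippenhahn
end

noncomputable section

namespace Kippenhahn

open Finset Matrix

/-! ### Higher-rank numerical ranges and isotropic subspaces -/

theorem mem_higherRankNumericalRange_iff_zero_mem {n k : ℕ} {A : Matrix (Fin n) (Fin n) ℂ} {z : ℂ} :
    z ∈ higherRankNumericalRange k A ↔ 0 ∈ higherRankNumericalRange k (A - z • 1) := by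
  refine exists_congr fun P => and_congr_right fun hP => and_congr_right fun _ => ?_
  have h : P * (A - z • 1) * P = P * A * P - z • P := by
    rw [Matrix.mul_sub, Matrix.sub_mul, Matrix.mul_smul, Matrix.mul_one, Matrix.smul_mul,
      hP.isIdempotentElem.eq]
  rw [h, zero_smul, sub_eq_zero]

open scoped ComplexOrder in
-- The required projection is `X (XᴴX)⁻¹ Xᴴ`, the orthogonal projection onto the column space of
-- `X`.
theorem zero_mem_higherRankNumericalRange_of_isotropic {n k : ℕ} {A : Matrix (Fin n) (Fin n) ℂ}
    (X : Matrix (Fin n) (Fin k) ℂ) (hX : LinearIndependent ℂ X.col) (hA : Xᴴ * A * X = 0) :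
    0 ∈ higherRankNumericalRange k A := by
  have hinj : Function.Injective X.mulVec := mulVec_injective_iff.2 hX
  have hpd : (Xᴴ * X).PosDef := PosDef.conjTranspose_mul_self X hinj
  have hu : IsUnit (Xᴴ * X).det := (isUnit_iff_isUnit_det _).1 hpd.isUnit
  set N := (Xᴴ * X)⁻¹ with hN
  have h1 : N * (Xᴴ * X) = 1 := nonsing_inv_mul _ hu
  have hNh : Nᴴ = N := by rw [hN, conjTranspose_nonsing_inv, hpd.1.eq]
  have hPX : X * N * Xᴴ * X = X := by
    rw [Matrix.mul_assoc, Matrix.mul_assoc, h1, Matrix.mul_one]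
  refine ⟨X * N * Xᴴ, ⟨?_, ?_⟩, ?_, ?_⟩
  · rw [IsIdempotentElem, ← Matrix.mul_assoc, ← Matrix.mul_assoc, hPX]
  · rw [IsSelfAdjoint, star_eq_conjTranspose, conjTranspose_mul, conjTranspose_mul,
      conjTranspose_conjTranspose, hNh, Matrix.mul_assoc]
  · have hrX : X.rank = k := by simpa using hX.rank_matrix
    refine le_antisymm ?_ ?_
    · rw [Matrix.mul_assoc]
      exact (rank_mul_le_left _ _).trans hrX.le
    · conv_lhs => rw [← hrX, ← hPX]
      exact rank_mul_le_left _ _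
  · rw [zero_smul]
    calc X * N * Xᴴ * A * (X * N * Xᴴ) = X * N * (Xᴴ * A * X) * N * Xᴴ := by
          simp only [Matrix.mul_assoc]
      _ = 0 := by rw [hA]; simp

/-! ### Compactness of the projections and closedness of the numerical range -/

theorem trace_eq_rank {n : ℕ} {P : Matrix (Fin n) (Fin n) ℂ} (hP : IsIdempotentElem P) :
    P.trace = P.rank := by
  have h : IsIdempotentElem (toLin' P) := by
    rw [IsIdempotentElem, Module.End.mul_eq_comp, ← toLin'_mul, hP.eq]
  have := (LinearMap.IsIdempotentElem.isProj_range _ h).trace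
  rwa [trace_toLin'_eq] at this

theorem norm_apply_le_one {n : ℕ} {P : Matrix (Fin n) (Fin n) ℂ} (hP : IsStarProjection P)
    (i j : Fin n) : ‖P i j‖ ≤ 1 := by
  have hs : ∀ i j, P j i = star (P i j) := fun i j =>
    (congrFun (congrFun hP.isSelfAdjoint.star_eq j) i).symm
  have h1 : P i i = ((∑ j, ‖P i j‖ ^ 2 : ℝ) : ℂ) := by
    conv_lhs => rw [← hP.isIdempotentElem.eq, mul_apply]
    rw [Complex.ofReal_sum]
    refine sum_congr rfl fun j _ => ?_
    rw [hs i j, RCLike.star_def, Complex.mul_conj, Complex.normSq_eq_norm_sq]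
  have h2 : ∀ j, ‖P i j‖ ^ 2 ≤ ‖P i i‖ := fun j => by
    rw [h1, Complex.norm_real, Real.norm_of_nonneg (sum_nonneg fun _ _ => sq_nonneg _)]
    exact single_le_sum (f := fun j => ‖P i j‖ ^ 2) (fun _ _ => sq_nonneg _) (mem_univ j)
  have h3 := h2 i
  have h4 := h2 j
  have h5 : ‖P i i‖ ≤ 1 := by nlinarith [norm_nonneg (P i i)]
  nlinarith [norm_nonneg (P i j)]

/-- Rank is not continuous, but on idempotents it equals the trace, so fixing it is a closed
condition; the entries are bounded by `1`. -/
theorem isCompact_starProjections (n k : ℕ) :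
    IsCompact {P : Matrix (Fin n) (Fin n) ℂ | IsStarProjection P ∧ P.rank = k} := by
  have h1 : IsCompact (Set.univ.pi fun _ : Fin n => Set.univ.pi fun _ : Fin n =>
      Metric.closedBall (0 : ℂ) 1) :=
    isCompact_univ_pi fun _ => isCompact_univ_pi fun _ => isCompact_closedBall 0 1
  have h2 : {P : Matrix (Fin n) (Fin n) ℂ | IsStarProjection P ∧ P.rank = k} =
      {P | P * P = P} ∩ ({P | star P = P} ∩ {P | P.trace = (k : ℂ)}) := by
    ext P
    constructor
    · rintro ⟨h, h'⟩
      exact ⟨h.isIdempotentElem, h.isSelfAdjoint, by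
        rw [Set.mem_ofPred_eq, trace_eq_rank h.isIdempotentElem, h']⟩
    · rintro ⟨h, h', h''⟩
      refine ⟨⟨h, h'⟩, ?_⟩
      rw [Set.mem_ofPred_eq, trace_eq_rank h] at h''
      exact_mod_cast h''
  refine h1.of_isClosed_subset ?_ fun P hP => ?_
  · rw [h2]
    exact (isClosed_eq (by fun_prop) (by fun_prop)).inter
      ((isClosed_eq (by fun_prop) (by fun_prop)).inter (isClosed_eq (by fun_prop) (by fun_prop)))
  · exact fun i _ j _ => mem_closedBall_zero_iff.2 (norm_apply_le_one hP.1 i j)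

/-- Projection along a compact factor is a closed map. Closedness in `A` removes the perturbations
below, and closedness in `z` puts boundary points in `Λ_k(A)`. -/
theorem isClosed_setOf_mem_higherRankNumericalRange (n k : ℕ) :
    IsClosed {p : ℂ × Matrix (Fin n) (Fin n) ℂ | p.1 ∈ higherRankNumericalRange k p.2} := by
  let C := {P : Matrix (Fin n) (Fin n) ℂ | IsStarProjection P ∧ P.rank = k}
  have : CompactSpace C := isCompact_iff_compactSpace.1 (isCompact_starProjections n k)
  have h : IsClosed {x : (ℂ × Matrix (Fin n) (Fin n) ℂ) × C |
      (x.2 : Matrix (Fin n) (Fin n) ℂ) * x.1.2 * x.2 = x.1.1 • (x.2 : Matrix (Fin n) (Fin n) ℂ)} :=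
    isClosed_eq (by fun_prop) (by fun_prop)
  convert isClosedMap_fst_of_compactSpace _ h
  ext ⟨z, A⟩
  constructor
  · rintro ⟨P, h1, h2, h3⟩
    exact ⟨((z, A), ⟨P, h1, h2⟩), h3, rfl⟩
  · rintro ⟨⟨_, P⟩, h1, rfl⟩
    exact ⟨P, P.2.1, P.2.2, h1⟩

/-! ### The strict form of the Li–Sze theorem -/

theorem exists_eigenbasis {n : ℕ} (M : Matrix (Fin n) (Fin n) ℂ) (hM : M.charpoly.Separable) :
    ∃ (V : Matrix (Fin n) (Fin n) ℂ) (μ : Fin n → ℂ), IsUnit V.det ∧ Function.Injective μ ∧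
      M * V = V * diagonal μ := by
  classical
  have hcard : M.charpoly.roots.toFinset.card = n := by
    rw [Multiset.toFinset_card_of_nodup (Polynomial.nodup_roots hM),
      ← (IsAlgClosed.splits M.charpoly).natDegree_eq_card_roots, charpoly_natDegree_eq_dim,
      Fintype.card_fin]
  let e := (M.charpoly.roots.toFinset.equivFinOfCardEq hcard).symm
  let μ : Fin n → ℂ := fun i => e i
  have hμ : Function.Injective μ := Subtype.val_injective.comp e.injective
  have h1 : ∀ i, ∃ v, Module.End.HasEigenvector (toLin' M) (μ i) v := by
    intro i
    refine Module.End.HasEigenvalue.exists_hasEigenvector ?_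
    have h2 : (μ i) ∈ M.charpoly.roots := Multiset.mem_toFinset.1 (e i).2
    rw [Module.End.hasEigenvalue_iff_isRoot_charpoly, charpoly_toLin']
    exact Polynomial.isRoot_of_mem_roots h2
  choose v hv using h1
  have hli := Module.End.eigenvectors_linearIndependent' _ μ hμ v hv
  refine ⟨Matrix.of fun i j => v j i, μ, ?_, hμ, ?_⟩
  · rw [← isUnit_iff_isUnit_det]
    exact linearIndependent_cols_iff_isUnit.1 hli
  · ext i j
    have := congrFun (hv j).apply_eq_smul i
    rw [mul_diagonal]
    rw [toLin'_apply, Pi.smul_apply, smul_eq_mul, mul_comm] at this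
    exact this

/-- Congruence by an eigenbasis `V` of `H⁻¹ K` turns the pair into `G = Vᴴ H V` and `G * diagonal
μ`; it preserves the indices and carries isotropic subspaces back. -/
theorem zero_mem_of_separable {n q : ℕ} {H K : Matrix (Fin n) (Fin n) ℂ} (hH : H.IsHermitian)
    (hK : K.IsHermitian) (hdet : IsUnit H.det) (hsep : (H⁻¹ * K).charpoly.Separable)
    (hmax : ∀ d, HasPosSubspace H d → d ≤ q)
    (hall : ∀ c s : ℝ, (c, s) ≠ 0 → HasPosSubspace (c • H + s • K) q) {k : ℕ} (hk : k ≤ q) :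
    0 ∈ higherRankNumericalRange k (H + Complex.I • K) := by
  obtain ⟨V, μ, hV, hμ, hVμ⟩ := exists_eigenbasis _ hsep
  have hKV : Vᴴ * K * V = Vᴴ * H * V * diagonal μ := by
    calc Vᴴ * K * V = Vᴴ * (H * H⁻¹ * K) * V := by rw [mul_nonsing_inv H hdet, Matrix.one_mul]
      _ = Vᴴ * H * (H⁻¹ * K * V) := by simp only [Matrix.mul_assoc]
      _ = _ := by rw [hVμ]; simp only [Matrix.mul_assoc]
  obtain ⟨X, h1, h2, h3⟩ := exists_isotropic_of_diagonal (G := Vᴴ * H * V) hμ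
    (isHermitian_conjTranspose_mul_mul V hH)
    (by rw [← hKV]; exact isHermitian_conjTranspose_mul_mul V hK)
    (by
      rw [det_mul, det_mul, det_conjTranspose]
      exact (hV.star.mul hdet).mul hV)
    (fun d hd => hmax d hd.of_conjTranspose_mul_mul)
    (fun c s hcs => by
      rw [← hKV]
      convert (hall c s hcs).conjTranspose_mul_mul hV using 1
      simp only [Matrix.mul_add, Matrix.add_mul, Matrix.mul_smul, Matrix.smul_mul])
  rw [← hKV] at h2
  have hiso : (V * X)ᴴ * (H + Complex.I • K) * (V * X) = 0 := by
    calc (V * X)ᴴ * (H + Complex.I • K) * (V * X) =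
        Xᴴ * (Vᴴ * H * V) * X + Complex.I • (Xᴴ * (Vᴴ * K * V) * X) := by
          simp only [conjTranspose_mul, Matrix.mul_add, Matrix.add_mul, Matrix.mul_smul,
            Matrix.smul_mul, Matrix.mul_assoc]
      _ = 0 := by rw [h1, h2]; simp
  have hli : LinearIndependent ℂ (V * X).col := by
    rw [← mulVec_injective_iff] at h3 ⊢
    have : (V * X).mulVec = V.mulVec ∘ X.mulVec := by ext; simp
    rw [this]
    exact (mulVec_injective_of_isUnit ((isUnit_iff_isUnit_det V).2 hV)).comp h3
  refine zero_mem_higherRankNumericalRange_of_isotropic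
    ((V * X).submatrix id (Fin.castLE hk)) (hli.comp _ (Fin.castLE_injective hk)) ?_
  ext i j
  exact congrFun (congrFun hiso (Fin.castLE hk i)) (Fin.castLE hk j)

/-- Directions may be scaled to the unit sphere, which is compact, so the open condition holds
uniformly over it. -/
theorem isOpen_setOf_forall_hasPosSubspace (n q : ℕ) :
    IsOpen {p : Matrix (Fin n) (Fin n) ℂ × Matrix (Fin n) (Fin n) ℂ |
      ∀ c s : ℝ, (c, s) ≠ 0 → HasPosSubspace (c • p.1 + s • p.2) q} := by
  rw [isOpen_iff_eventually]
  intro p hp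
  have hC : IsCompact (Metric.sphere (0 : ℝ × ℝ) 1) := isCompact_sphere 0 1
  have h1 : ∀ᶠ p' in nhds p, ∀ x ∈ Metric.sphere (0 : ℝ × ℝ) 1,
      HasPosSubspace (x.1 • p'.1 + x.2 • p'.2) q := by
    refine hC.eventually_forall_of_forall_eventually fun x hx => ?_
    have hcont : Continuous fun z : (Matrix (Fin n) (Fin n) ℂ × Matrix (Fin n) (Fin n) ℂ) × (ℝ × ℝ)
        => z.2.1 • z.1.1 + z.2.2 • z.1.2 := by fun_prop
    have hmem : HasPosSubspace (x.1 • p.1 + x.2 • p.2) q :=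
      hp x.1 x.2 fun h => by rw [show x = 0 from h] at hx; simp at hx
    exact ((isOpen_hasPosSubspace q).preimage hcont).mem_nhds hmem
  filter_upwards [h1] with p' hp' c s hcs
  have hn : 0 < ‖(c, s)‖ := norm_pos_iff.2 hcs
  have h2 := (hp' (‖(c, s)‖⁻¹ • (c, s)) (by
    rw [mem_sphere_zero_iff_norm, norm_smul, norm_inv, norm_norm, inv_mul_cancel₀ hn.ne'])).smul hn
  convert h2 using 1
  simp only [Prod.smul_fst, Prod.smul_snd, smul_add, smul_smul, smul_eq_mul]
  rw [mul_inv_cancel_left₀ hn.ne', mul_inv_cancel_left₀ hn.ne']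

/-! ### Reduction to generic pencils by perturbation -/

theorem eventually_eval_ne_zero {D : Polynomial ℂ} (hD0 : D ≠ 0) :
    ∀ᶠ ε : ℝ in nhdsWithin 0 {0}ᶜ, D.eval (ε : ℂ) ≠ 0 := by
  have hfin : Set.Finite {ε : ℝ | D.eval (ε : ℂ) = 0} :=
    Set.Finite.preimage Complex.ofReal_injective.injOn (Polynomial.finite_setOfPred_isRoot hD0)
  have := (hfin.subset Set.sdiff_subset : ({ε : ℝ | D.eval (ε : ℂ) = 0} \ {0}).Finite).isClosed
  have h6 := this.isOpen_compl.mem_nhds (x := (0 : ℝ)) (by simp)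
  filter_upwards [nhdsWithin_le_nhds h6, self_mem_nhdsWithin] with ε h7 h8 h9
  exact h7 ⟨h9, h8⟩

theorem eventually_separable {n : ℕ} (M M₁ : Matrix (Fin n) (Fin n) ℂ)
    (h : M₁.charpoly.Separable) :
    ∀ᶠ ε : ℝ in nhdsWithin 0 {0}ᶜ, (M + (ε : ℂ) • (M₁ - M)).charpoly.Separable := by
  classical
  let N : Matrix (Fin n) (Fin n) (Polynomial ℂ) :=
    M.map Polynomial.C + (Polynomial.X : Polynomial ℂ) • (M₁ - M).map Polynomial.C
  have hN : ∀ z : ℂ, (N.map (Polynomial.evalRingHom z)) = M + z • (M₁ - M) := by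
    intro z
    ext i j
    simp [N]
  -- The discriminant along the line from `M` to `M₁`, up to normalization: a polynomial in the
  -- parameter, nonzero at `1`. Fixing the formal degrees `n` and `n - 1` makes it commute with
  -- specialization.
  let D := Polynomial.resultant N.charpoly (Polynomial.derivative N.charpoly) n (n - 1)
  have hD : ∀ z : ℂ, D.eval z ≠ 0 ↔ (M + z • (M₁ - M)).charpoly.Separable := by
    intro z
    have h1 : (M + z • (M₁ - M)).charpoly = N.charpoly.map (Polynomial.evalRingHom z) := by
      rw [← charpoly_map, hN]
    have h2 : D.eval z = Polynomial.resultant (M + z • (M₁ - M)).charpoly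
        (Polynomial.derivative (M + z • (M₁ - M)).charpoly) n (n - 1) := by
      rw [h1, Polynomial.derivative_map, Polynomial.resultant_map_map]
      rfl
    have h3 : (M + z • (M₁ - M)).charpoly.natDegree = n := by simp
    have h4 := Polynomial.resultant_eq_zero_iff (f := (M + z • (M₁ - M)).charpoly)
      (g := Polynomial.derivative (M + z • (M₁ - M)).charpoly)
    rw [Polynomial.natDegree_derivative, h3, ← h2] at h4
    rw [Ne, h4, Polynomial.Separable]
    simp [(charpoly_monic (M + z • (M₁ - M))).ne_zero]
  have hD0 : D ≠ 0 := by
    intro h0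
    have := (hD 1).2 (by simpa using h)
    simp [h0] at this
  filter_upwards [eventually_eval_ne_zero hD0] with ε hε
  exact (hD ε).1 hε

/-- For a nonsingular Hermitian matrix `H` some Hermitian `K` makes `H⁻¹ K` have distinct
eigenvalues. -/
theorem exists_hermitian_separable {n : ℕ} {H : Matrix (Fin n) (Fin n) ℂ} (hH : H.IsHermitian)
    (hdet : IsUnit H.det) :
    ∃ K : Matrix (Fin n) (Fin n) ℂ, K.IsHermitian ∧ (H⁻¹ * K).charpoly.Separable := by
  let U : Matrix (Fin n) (Fin n) ℂ := hH.eigenvectorUnitary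
  have hUU : Uᴴ * U = 1 := Unitary.coe_star_mul_self hH.eigenvectorUnitary
  let D : Matrix (Fin n) (Fin n) ℂ := diagonal fun i => ((i : ℕ) : ℂ)
  let E : Matrix (Fin n) (Fin n) ℂ := diagonal fun i => (hH.eigenvalues i : ℂ)
  have hHE : H = U * E * Uᴴ := hH.spectral_theorem
  -- `U * D * Uᴴ` has eigenvalues `0, …, n - 1` and commutes with `H`, having the same eigenvectors,
  -- so the product is Hermitian.
  refine ⟨H * (U * D * Uᴴ), ?_, ?_⟩
  · have h1 : H * (U * D * Uᴴ) = Uᴴᴴ * (E * D) * Uᴴ := by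
      conv_lhs => rw [hHE]
      calc U * E * Uᴴ * (U * D * Uᴴ) = U * E * (Uᴴ * U) * D * Uᴴ := by
            simp only [Matrix.mul_assoc]
        _ = _ := by rw [hUU, Matrix.mul_one, conjTranspose_conjTranspose, Matrix.mul_assoc U]
    rw [h1]
    refine isHermitian_conjTranspose_mul_mul _ ?_
    rw [diagonal_mul_diagonal]
    refine isHermitian_diagonal_of_self_adjoint _ ?_
    ext i
    simp
  · rw [← Matrix.mul_assoc, nonsing_inv_mul H hdet, Matrix.one_mul, Matrix.charpoly_mul_comm,
      ← Matrix.mul_assoc, hUU, Matrix.one_mul, charpoly_diagonal,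
      Polynomial.separable_prod_X_sub_C_iff]
    exact fun i j h => Fin.ext (Nat.cast_injective h)

theorem isClosed_setOf_zero_mem (n k : ℕ) :
    IsClosed {A : Matrix (Fin n) (Fin n) ℂ | 0 ∈ higherRankNumericalRange k A} :=
  (isClosed_setOf_mem_higherRankNumericalRange n k).preimage (f := fun A => (0, A)) (by fun_prop)

theorem zero_mem_of_isUnit {n q : ℕ} {H K : Matrix (Fin n) (Fin n) ℂ} (hH : H.IsHermitian)
    (hK : K.IsHermitian) (hdet : IsUnit H.det) (hmax : ∀ d, HasPosSubspace H d → d ≤ q)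
    (hall : ∀ c s : ℝ, (c, s) ≠ 0 → HasPosSubspace (c • H + s • K) q) {k : ℕ} (hk : k ≤ q) :
    0 ∈ higherRankNumericalRange k (H + Complex.I • K) := by
  obtain ⟨K₁, hK₁, hsep⟩ := exists_hermitian_separable hH hdet
  have hcont : Continuous fun ε : ℝ => K + (ε : ℂ) • (K₁ - K) := by fun_prop
  have h1 : ∀ᶠ ε : ℝ in nhdsWithin 0 {0}ᶜ,
      0 ∈ higherRankNumericalRange k (H + Complex.I • (K + (ε : ℂ) • (K₁ - K))) := by
    have h2 := eventually_separable (H⁻¹ * K) (H⁻¹ * K₁) hsep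
    have h3 : ∀ᶠ ε : ℝ in nhds 0, ∀ c s : ℝ, (c, s) ≠ 0 →
        HasPosSubspace (c • H + s • (K + (ε : ℂ) • (K₁ - K))) q := by
      have h4 : Continuous fun ε : ℝ => (H, K + (ε : ℂ) • (K₁ - K)) := by fun_prop
      exact h4.continuousAt.eventually
        ((isOpen_setOf_forall_hasPosSubspace n q).mem_nhds (by simpa using hall))
    filter_upwards [h2, nhdsWithin_le_nhds h3] with ε h5 h6
    refine zero_mem_of_separable hH ?_ hdet ?_ hmax h6 hk
    · refine hK.add ?_
      rw [IsHermitian, conjTranspose_smul, (hK₁.sub hK).eq]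
      simp
    · convert h5 using 2
      simp only [Matrix.mul_add, Matrix.mul_smul, Matrix.mul_sub]
  have h7 : Filter.Tendsto (fun ε : ℝ => H + Complex.I • (K + (ε : ℂ) • (K₁ - K)))
      (nhdsWithin 0 {0}ᶜ) (nhds (H + Complex.I • K)) := by
    have : Continuous fun ε : ℝ => H + Complex.I • (K + (ε : ℂ) • (K₁ - K)) := by fun_prop
    have := this.tendsto 0
    simp only [Complex.ofReal_zero, zero_smul, add_zero] at this
    exact this.mono_left nhdsWithin_le_nhds
  exact (isClosed_setOf_zero_mem n k).mem_of_tendsto h7 h1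

theorem zero_mem_of_index_le {n q : ℕ} {H K : Matrix (Fin n) (Fin n) ℂ} (hH : H.IsHermitian)
    (hK : K.IsHermitian) (hmax : ∀ d, HasPosSubspace H d → d ≤ q)
    (hall : ∀ c s : ℝ, (c, s) ≠ 0 → HasPosSubspace (c • H + s • K) q) {k : ℕ} (hk : k ≤ q) :
    0 ∈ higherRankNumericalRange k (H + Complex.I • K) := by
  -- The shift must be downwards: `H - ε` with `ε > 0` has positive index no larger than that of
  -- `H`, so `hmax` persists.
  have h1 : ∀ᶠ ε : ℝ in nhdsWithin 0 (Set.Ioi 0),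
      0 ∈ higherRankNumericalRange k (H - (ε : ℂ) • (1 : Matrix (Fin n) (Fin n) ℂ) +
        Complex.I • K) := by
    have h2 : ∀ᶠ ε : ℝ in nhdsWithin 0 {0}ᶜ,
        IsUnit (H - (ε : ℂ) • (1 : Matrix (Fin n) (Fin n) ℂ)).det := by
      filter_upwards [eventually_eval_ne_zero (charpoly_monic H).ne_zero] with ε hε
      rw [eval_charpoly] at hε
      rw [scalar_apply, ← smul_one_eq_diagonal, ← neg_sub, det_neg] at hε
      exact isUnit_iff_ne_zero.2 (right_ne_zero_of_mul hε)
    have h3 : ∀ᶠ ε : ℝ in nhds 0, ∀ c s : ℝ, (c, s) ≠ 0 →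
        HasPosSubspace (c • (H - (ε : ℂ) • (1 : Matrix (Fin n) (Fin n) ℂ)) + s • K) q := by
      have h4 : Continuous fun ε : ℝ => (H - (ε : ℂ) • (1 : Matrix (Fin n) (Fin n) ℂ), K) := by
        fun_prop
      exact h4.continuousAt.eventually
        ((isOpen_setOf_forall_hasPosSubspace n q).mem_nhds (by simpa using hall))
    have h2' := nhdsWithin_mono (0 : ℝ) (fun x (hx : 0 < x) => hx.ne') h2
    filter_upwards [h2', nhdsWithin_le_nhds h3, self_mem_nhdsWithin] with ε h5 h6 h7
    refine zero_mem_of_isUnit ?_ hK h5 (fun d hd => hmax d (hd.mono fun x => ?_)) h6 hk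
    · refine hH.sub ?_
      rw [IsHermitian, conjTranspose_smul, conjTranspose_one]
      simp
    · rw [sub_mulVec, smul_mulVec, one_mulVec, dotProduct_sub, dotProduct_smul, Complex.sub_re,
        smul_eq_mul, Complex.re_ofReal_mul, sub_le_self_iff]
      refine mul_nonneg (le_of_lt h7) ?_
      rw [dotProduct, Complex.re_sum]
      refine sum_nonneg fun i _ => ?_
      rw [Pi.star_apply, RCLike.star_def, ← Complex.normSq_eq_conj_mul_self, Complex.ofReal_re]
      exact Complex.normSq_nonneg _
  have h7 : Filter.Tendsto (fun ε : ℝ => H - (ε : ℂ) • (1 : Matrix (Fin n) (Fin n) ℂ) +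
      Complex.I • K) (nhdsWithin 0 (Set.Ioi 0)) (nhds (H + Complex.I • K)) := by
    have : Continuous fun ε : ℝ => H - (ε : ℂ) • (1 : Matrix (Fin n) (Fin n) ℂ) +
      Complex.I • K := by fun_prop
    have := this.tendsto 0
    simp only [Complex.ofReal_zero, zero_smul, sub_zero] at this
    exact this.mono_left nhdsWithin_le_nhds
  exact (isClosed_setOf_zero_mem n k).mem_of_tendsto h7 h1

/-- If every real combination of the Hermitian matrices `H` and `K` is positive definite on some
subspace of dimension `k`, then the two forms vanish on a common subspace of dimension `k`. -/
theorem zero_mem_of_forall_hasPosSubspace {n k : ℕ} {H K : Matrix (Fin n) (Fin n) ℂ}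
    (hH : H.IsHermitian) (hK : K.IsHermitian)
    (hall : ∀ c s : ℝ, (c, s) ≠ 0 → HasPosSubspace (c • H + s • K) k) :
    0 ∈ higherRankNumericalRange k (H + Complex.I • K) := by
  classical
  -- `q` is the least positive index over all directions. By minimality every other direction has a
  -- positive subspace of dimension `q`.
  have hex : ∃ q, ∃ c s : ℝ, (c, s) ≠ 0 ∧ ∀ d, HasPosSubspace (c • H + s • K) d → d ≤ q :=
    ⟨n, 1, 0, by simp, fun d hd => by
      simpa using hd.le_finrank LinearMap.id fun x hx => by
        rw [show x = 0 from hx]; simp⟩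
  obtain ⟨c, s, hcs, hmax⟩ := Nat.find_spec hex
  set q := Nat.find hex with hq
  have hqall : ∀ c s : ℝ, (c, s) ≠ 0 → HasPosSubspace (c • H + s • K) q := by
    intro c' s' hcs'
    by_contra hno
    have hq0 : q ≠ 0 := fun h0 => hno (by
      rw [h0]
      exact ⟨0, fun x hx => absurd (Subsingleton.elim x 0) hx⟩)
    refine Nat.find_min hex (m := q - 1) (by omega) ⟨c', s', hcs', fun d hd => ?_⟩
    by_contra hlt
    exact hno (hd.of_le (by omega))
  have hreal : ∀ (r : ℝ) {B : Matrix (Fin n) (Fin n) ℂ}, B.IsHermitian → (r • B).IsHermitian := by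
    intro r B hB
    rw [IsHermitian, conjTranspose_smul, hB.eq, star_trivial]
  have hpos : 0 < c ^ 2 + s ^ 2 := by
    by_contra h
    have h1 : c = 0 := by nlinarith [sq_nonneg c, sq_nonneg s]
    have h2 : s = 0 := by nlinarith [sq_nonneg c, sq_nonneg s]
    exact hcs (by rw [h1, h2]; rfl)
  -- Multiplying `H + iK` by `c - is` makes the minimizing combination the first Hermitian part and
  -- does not affect whether `0` is in the range.
  obtain ⟨P, h1, h2, h3⟩ := zero_mem_of_index_le (H := c • H + s • K) (K := (-s) • H + c • K)
    ((hreal c hH).add (hreal s hK)) ((hreal (-s) hH).add (hreal c hK)) hmax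
    (fun x y hxy => by
      have h1 : x • (c • H + s • K) + y • ((-s) • H + c • K) =
          (x * c - y * s) • H + (x * s + y * c) • K := by module
      rw [h1]
      refine hqall _ _ fun h0 => hxy ?_
      obtain ⟨h2, h3⟩ := Prod.mk.inj h0
      have h4 : x * (c ^ 2 + s ^ 2) = 0 := by linear_combination c * h2 + s * h3
      have h5 : y * (c ^ 2 + s ^ 2) = 0 := by linear_combination c * h3 - s * h2
      rw [(mul_eq_zero.1 h4).resolve_right hpos.ne', (mul_eq_zero.1 h5).resolve_right hpos.ne']
      rfl) (hmax k (hall c s hcs))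
  refine ⟨P, h1, h2, ?_⟩
  have h4 : c • H + s • K + Complex.I • ((-s) • H + c • K) =
      ((c : ℂ) - s * Complex.I) • (H + Complex.I • K) := by
    ext i j
    simp only [Matrix.add_apply, Matrix.smul_apply, smul_eq_mul, Complex.real_smul,
      Complex.ofReal_neg]
    linear_combination (s : ℂ) * K i j * Complex.I_sq
  rw [h4, Matrix.mul_smul, Matrix.smul_mul, zero_smul, smul_eq_zero] at h3
  rw [zero_smul]
  refine h3.resolve_left fun h0 => hcs ?_
  have h5 := congrArg Complex.re h0
  have h6 := congrArg Complex.im h0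
  simp at h5 h6
  rw [h5, h6]
  rfl

end Kippenhahn
end

noncomputable section

namespace Kippenhahn

open Finset Matrix

/-! ### Eigenvalues near zero -/

/-- A Hermitian form is diagonal in suitable orthonormal coordinates. -/
theorem exists_unitary_diagonalization {n : ℕ} {B : Matrix (Fin n) (Fin n) ℂ}
    (hB : B.IsHermitian) :
    ∃ (U : (Fin n → ℂ) ≃ₗ[ℂ] (Fin n → ℂ)) (ev : Fin n → ℝ),
      (∀ x, (star (U x) ⬝ᵥ B *ᵥ U x).re = ∑ i, ev i * Complex.normSq (x i)) ∧
      (∀ x, ∑ i, Complex.normSq (U x i) = ∑ i, Complex.normSq (x i)) ∧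
      ∀ i, (B - (ev i : ℂ) • 1).det = 0 := by
  let W : Matrix (Fin n) (Fin n) ℂ := hB.eigenvectorUnitary
  have hWW : Wᴴ * W = 1 := Unitary.coe_star_mul_self hB.eigenvectorUnitary
  have hWW' : W * Wᴴ = 1 := Unitary.coe_mul_star_self hB.eigenvectorUnitary
  have hBE : B = W * (diagonal fun i => (hB.eigenvalues i : ℂ)) * Wᴴ := hB.spectral_theorem
  have hE : Wᴴ * B * W = diagonal fun i => (hB.eigenvalues i : ℂ) := by
    calc Wᴴ * B * W = (Wᴴ * W) * (diagonal fun i => (hB.eigenvalues i : ℂ)) * (Wᴴ * W) := by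
          conv_lhs => rw [hBE]
          simp only [Matrix.mul_assoc]
      _ = _ := by rw [hWW, Matrix.one_mul, Matrix.mul_one]
  have hsq : ∀ x : Fin n → ℂ, star x ⬝ᵥ x = ((∑ i, Complex.normSq (x i) : ℝ) : ℂ) := fun x => by
    rw [dotProduct, Complex.ofReal_sum]
    exact sum_congr rfl fun i _ => by
      rw [Pi.star_apply, RCLike.star_def, Complex.normSq_eq_conj_mul_self]
  have hU : ∀ x, toLin'OfInv hWW hWW' x = W *ᵥ x := fun x => by
    ext i
    simp
  refine ⟨toLin'OfInv hWW hWW', hB.eigenvalues, fun x => ?_, fun x => ?_, fun i => ?_⟩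
  · have h1 : star (W *ᵥ x) ⬝ᵥ B *ᵥ (W *ᵥ x) = star x ⬝ᵥ (Wᴴ * B * W) *ᵥ x := by
      simp [← mulVec_mulVec, dotProduct_mulVec, star_mulVec, vecMul_vecMul]
    rw [hU, h1, hE, dotProduct, Complex.re_sum]
    refine sum_congr rfl fun i _ => ?_
    rw [mulVec_diagonal, Pi.star_apply, RCLike.star_def, mul_left_comm,
      ← Complex.normSq_eq_conj_mul_self, ← Complex.ofReal_mul, Complex.ofReal_re]
  · rw [← Complex.ofReal_inj, ← hsq, ← hsq, hU, star_mulVec,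
      ← dotProduct_mulVec, mulVec_mulVec, hWW, one_mulVec]
  · have h1 : B - (hB.eigenvalues i : ℂ) • 1 =
        W * (diagonal fun j => ((hB.eigenvalues j : ℂ) - hB.eigenvalues i)) * Wᴴ := by
      have h2 : (diagonal fun j => ((hB.eigenvalues j : ℂ) - hB.eigenvalues i)) =
          (diagonal fun j => (hB.eigenvalues j : ℂ)) -
            (hB.eigenvalues i : ℂ) • (1 : Matrix (Fin n) (Fin n) ℂ) := by
        rw [smul_one_eq_diagonal, diagonal_sub]
      rw [h2, Matrix.mul_sub, Matrix.sub_mul, ← hBE, Matrix.mul_smul, Matrix.smul_mul,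
        Matrix.mul_one, hWW']
    rw [h1, det_mul, det_mul, det_diagonal, prod_eq_zero (mem_univ i) (sub_self _)]
    simp

theorem exists_form_bound {n : ℕ} {B : Matrix (Fin n) (Fin n) ℂ} (hB : B.IsHermitian) :
    ∃ C : ℝ, 0 ≤ C ∧ ∀ x, |(star x ⬝ᵥ B *ᵥ x).re| ≤ C * ∑ i, Complex.normSq (x i) := by
  obtain ⟨U, ev, h1, h2, -⟩ := exists_unitary_diagonalization hB
  refine ⟨∑ i, |ev i|, sum_nonneg fun _ _ => abs_nonneg _, fun x => ?_⟩
  obtain ⟨y, rfl⟩ := U.surjective x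
  rw [h1, h2, mul_sum]
  refine (abs_sum_le_sum_abs _ _).trans (sum_le_sum fun i _ => ?_)
  rw [abs_mul, abs_of_nonneg (Complex.normSq_nonneg _)]
  exact mul_le_mul_of_nonneg_right
    (single_le_sum (f := fun i => |ev i|) (fun _ _ => abs_nonneg _) (mem_univ i))
    (Complex.normSq_nonneg _)

/-- Let the form `B` be nonnegative on a subspace of dimension `k` and `δ`-close to a form `B₀` that
is positive definite on no such subspace. Then `B` has an eigenvalue in `[0, δ]`. -/
theorem exists_eigenvalue_mem_Icc {n k : ℕ} {B B₀ : Matrix (Fin n) (Fin n) ℂ} {δ : ℝ}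
    (hB : B.IsHermitian)
    (hclose : ∀ x, |(star x ⬝ᵥ B *ᵥ x).re - (star x ⬝ᵥ B₀ *ᵥ x).re| ≤
      δ * ∑ i, Complex.normSq (x i))
    (L : (Fin k → ℂ) →ₗ[ℂ] (Fin n → ℂ)) (hL : Function.Injective L)
    (hLB : ∀ x, 0 ≤ (star (L x) ⬝ᵥ B *ᵥ L x).re) (h₀ : ¬ HasPosSubspace B₀ k) :
    ∃ t : ℝ, 0 ≤ t ∧ t ≤ δ ∧ (B - (t : ℂ) • 1).det = 0 := by
  classical
  obtain ⟨U, ev, h1, h2, h3⟩ := exists_unitary_diagonalization hB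
  by_contra! hno
  have hev : ∀ i, ev i < 0 ∨ δ < ev i := fun i => by
    by_contra! h
    exact hno (ev i) h.1 h.2 (h3 i)
  -- With no eigenvalue in `[0, δ]`, the form `B` exceeds `δ` times the norm square on the
  -- eigenvectors of `Z`, so `B₀` is positive there; it remains to see `k ≤ Z.card`.
  set Z := univ.filter fun i => δ < ev i with hZ
  refine h₀ ?_
  have hpos : HasPosSubspace B₀ Z.card := by
    rw [← Fintype.card_coe]
    refine HasPosSubspace.of_fintype
      (U.toLinearMap ∘ₗ Function.ExtendByZero.linearMap ℂ (Subtype.val : Z → Fin n))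
      fun x hx => ?_
    set y : Fin n → ℂ := Function.ExtendByZero.linearMap ℂ (Subtype.val : Z → Fin n) x with hy
    have hyZ : ∀ j, j ∉ Z → y j = 0 := fun j hj =>
      Function.extend_apply' _ _ _ fun ⟨b, hb⟩ => hj (hb ▸ b.2)
    have hyx : ∀ b : Z, y b = x b := fun b => Subtype.val_injective.extend_apply _ _ _
    have h4 := hclose (U y)
    rw [h1, h2, mul_sum] at h4
    have h5 : 0 < ∑ i, ev i * Complex.normSq (y i) - ∑ i, δ * Complex.normSq (y i) := by
      rw [← sum_sub_distrib]
      obtain ⟨b, hb⟩ := Function.ne_iff.1 hx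
      refine sum_pos' (fun i _ => ?_) ⟨b, mem_univ _, ?_⟩
      · rw [← sub_mul]
        by_cases hi : i ∈ Z
        · exact mul_nonneg (sub_nonneg.2 (mem_filter.1 hi).2.le) (Complex.normSq_nonneg _)
        · simp [hyZ i hi]
      · rw [← sub_mul]
        exact mul_pos (sub_pos.2 (mem_filter.1 b.2).2)
          (Complex.normSq_pos.2 (by rw [hyx]; exact hb))
    have h6 := (abs_le.1 h4).2
    rw [LinearMap.comp_apply, ← hy, LinearEquiv.coe_coe]
    linarith
  refine hpos.of_le ?_
  -- A vector in the range of `L` without coordinates in `Z` involves only negative eigenvalues;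
  -- since `B` is nonnegative on it, it is zero.
  let T : (Fin k → ℂ) →ₗ[ℂ] (Z → ℂ) :=
    LinearMap.funLeft ℂ ℂ (Subtype.val : Z → Fin n) ∘ₗ U.symm.toLinearMap ∘ₗ L
  have hT : Function.Injective T := by
    rw [← LinearMap.ker_eq_bot, LinearMap.ker_eq_bot']
    intro x hx
    set y := U.symm (L x) with hy
    have hyL : U y = L x := by rw [hy, LinearEquiv.apply_symm_apply]
    have hyZ : ∀ j ∈ Z, y j = 0 := fun j hj => congrFun hx ⟨j, hj⟩
    have h4 := hLB x
    rw [← hyL, h1] at h4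
    have h5 : ∀ i ∈ univ, ev i * Complex.normSq (y i) ≤ 0 := fun i _ => by
      rcases hev i with h | h
      · exact mul_nonpos_of_nonpos_of_nonneg h.le (Complex.normSq_nonneg _)
      · simp [hyZ i (mem_filter.2 ⟨mem_univ _, h⟩)]
    have h6 := (sum_eq_zero_iff_of_nonpos h5).1 (le_antisymm (sum_nonpos h5) h4)
    have h7 : y = 0 := by
      ext i
      rcases hev i with h | h
      · exact Complex.normSq_eq_zero.1 ((mul_eq_zero.1 (h6 i (mem_univ i))).resolve_left h.ne)
      · exact hyZ i (mem_filter.2 ⟨mem_univ _, h⟩)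
    apply hL
    rw [← hyL, h7, map_zero, map_zero]
  simpa using LinearMap.finrank_le_finrank_of_injective hT

theorem exists_isotropic_of_mem {n k : ℕ} {A : Matrix (Fin n) (Fin n) ℂ} {z : ℂ}
    (h : z ∈ higherRankNumericalRange k A) :
    ∃ L : (Fin k → ℂ) →ₗ[ℂ] (Fin n → ℂ), Function.Injective L ∧
      ∀ x, star (L x) ⬝ᵥ (A - z • 1) *ᵥ L x = 0 := by
  obtain ⟨P, h1, h2, h3⟩ := mem_higherRankNumericalRange_iff_zero_mem.1 h
  rw [zero_smul] at h3
  have hfr : Module.finrank ℂ (Fin k → ℂ) = Module.finrank ℂ P.mulVecLin.range := by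
    rw [← h2, Matrix.rank]; simp
  let e := LinearEquiv.ofFinrankEq _ _ hfr
  refine ⟨P.mulVecLin.range.subtype ∘ₗ e.toLinearMap,
    Subtype.val_injective.comp e.injective, fun x => ?_⟩
  obtain ⟨y, hy⟩ := (e x).2
  have hPs : Pᴴ = P := h1.isSelfAdjoint
  have h4 : star (P *ᵥ y) ⬝ᵥ (A - z • 1) *ᵥ (P *ᵥ y) = star y ⬝ᵥ (P * (A - z • 1) * P) *ᵥ y := by
    conv_rhs => rw [← hPs]
    simp [← mulVec_mulVec, dotProduct_mulVec, star_mulVec, vecMul_vecMul, hPs]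
  have h5 : (P.mulVecLin.range.subtype ∘ₗ e.toLinearMap) x = P *ᵥ y := hy.symm
  rw [h5, h4, h3]
  simp

/-! ### The tangent point attached to a boundary point -/

theorem hasFDerivAt_eval (f : MvPolynomial (Fin 3) ℝ) (p : Fin 3 → ℝ) :
    HasFDerivAt (fun x => MvPolynomial.eval x f)
      (∑ i, MvPolynomial.eval p (MvPolynomial.pderiv i f) •
        (ContinuousLinearMap.proj i : (Fin 3 → ℝ) →L[ℝ] ℝ)) p := by
  induction f using MvPolynomial.induction_on with
  | C a => simpa using hasFDerivAt_const a p
  | add f g hf hg =>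
    refine ((hf.add hg).congr_fderiv ?_).congr_of_eventuallyEq (.of_forall fun x => by simp)
    ext x
    simp [add_mul, sum_add_distrib]
  | mul_X f j hf =>
    refine ((hf.mul (hasFDerivAt_apply (𝕜 := ℝ) j p)).congr_fderiv ?_).congr_of_eventuallyEq
      (.of_forall fun x => by simp)
    ext x
    simp [Pi.single_apply, MvPolynomial.pderiv_X, Derivation.leibniz, add_mul, sum_add_distrib,
      mul_sum, apply_ite, mul_assoc]

/-- If `c ≠ 0`, then `τ * l y` agrees with `c * y` to first order and so changes sign at `0`, which
`0 ≤ l` forbids. -/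
theorem directional_eq_zero {c τ : ℝ} (l : ℝ → ℝ) (hl : ∀ y, 0 ≤ l y)
    (hlo : (fun y => c * y - τ * l y) =o[nhds 0] fun y => y) : c = 0 := by
  by_contra hc
  have h1 := hlo.def (c := |c| / 2) (by positivity)
  obtain ⟨r, hr, h2⟩ := Metric.eventually_nhds_iff.1 h1
  have h3 := @h2 (r / 2) (by rw [Real.dist_eq, sub_zero, abs_of_pos (by positivity)]; linarith)
  have h4 := @h2 (-(r / 2)) (by
    rw [Real.dist_eq, sub_zero, abs_neg, abs_of_pos (by positivity)]; linarith)
  rw [Real.norm_eq_abs, Real.norm_eq_abs] at h3 h4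
  rw [abs_neg] at h4
  rw [abs_of_pos (show 0 < r / 2 by positivity)] at h3 h4
  obtain ⟨h5, h6⟩ := abs_le.1 h3
  obtain ⟨h7, h8⟩ := abs_le.1 h4
  have h9 := hl (r / 2)
  have h10 := hl (-(r / 2))
  rcases lt_or_gt_of_ne hc with h | h
  · rw [abs_of_neg h] at *
    have h11 : c * r < 0 := mul_neg_of_neg_of_pos h hr
    have h12 : τ * l (r / 2) < 0 := by linarith
    have h13 : 0 < τ * l (-(r / 2)) := by linarith
    have h14 : τ < 0 := by
      by_contra h; exact absurd (mul_nonneg (not_lt.1 h) h9) h12.not_ge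
    exact absurd (mul_nonpos_of_nonpos_of_nonneg h14.le h10) h13.not_ge
  · rw [abs_of_pos h] at *
    have h11 : 0 < c * r := mul_pos h hr
    have h12 : 0 < τ * l (r / 2) := by linarith
    have h13 : τ * l (-(r / 2)) < 0 := by linarith
    have h14 : 0 < τ := by
      by_contra h; exact absurd (mul_nonpos_of_nonpos_of_nonneg (not_lt.1 h) h9) h12.not_ge
    exact absurd (mul_nonneg h14.le h10) h13.not_ge

/-- A boundary point `a + i b` of `Λ_k(A)` is the dual point of a real tangent line of the curve
`f = 0`, or lies on the dual line of a singular point, for every `f` that vanishes at the real points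
of the Kippenhahn curve. -/
theorem exists_tangent_point {n k : ℕ} {A : Matrix (Fin n) (Fin n) ℂ} {a b : ℝ}
    (h : (a + b * Complex.I : ℂ) ∈ frontier (higherRankNumericalRange k A))
    (f : MvPolynomial (Fin 3) ℝ)
    (hf : ∀ v : Fin 3 → ℝ, ((v 0 : ℂ) • 1 + (v 1 : ℂ) • (ℜ A : Matrix (Fin n) (Fin n) ℂ) +
      (v 2 : ℂ) • (ℑ A : Matrix (Fin n) (Fin n) ℂ)).det = 0 → MvPolynomial.eval v f = 0) :
    ∃ p : Fin 3 → ℝ, p ≠ 0 ∧ p 0 + a * p 1 + b * p 2 = 0 ∧ MvPolynomial.eval p f = 0 ∧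
      MvPolynomial.eval p (MvPolynomial.pderiv 1 f) =
        a * MvPolynomial.eval p (MvPolynomial.pderiv 0 f) ∧
      MvPolynomial.eval p (MvPolynomial.pderiv 2 f) =
        b * MvPolynomial.eval p (MvPolynomial.pderiv 0 f) := by
  set H : Matrix (Fin n) (Fin n) ℂ := (ℜ A).1 with hH
  set K : Matrix (Fin n) (Fin n) ℂ := (ℑ A).1 with hK
  have hHh : H.IsHermitian := (ℜ A).2
  have hKh : K.IsHermitian := (ℑ A).2
  have hAHK : A = H + Complex.I • K := (realPart_add_I_smul_imaginaryPart A).symm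
  have hscal : ∀ r : ℝ, (r • (1 : Matrix (Fin n) (Fin n) ℂ)).IsHermitian := fun r => by
    rw [IsHermitian, conjTranspose_smul, conjTranspose_one, star_trivial]
  have hreal : ∀ (r : ℝ) {B : Matrix (Fin n) (Fin n) ℂ}, B.IsHermitian → (r • B).IsHermitian := by
    intro r B hB
    rw [IsHermitian, conjTranspose_smul, hB.eq, star_trivial]
  -- the shifted matrix has Hermitian parts `H - a` and `K - b`
  have hshift : ∀ z : ℂ, A - z • 1 = (H - z.re • 1) + Complex.I • (K - z.im • 1) := by
    intro z
    ext i j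
    rw [hAHK]
    conv_lhs => rw [← Complex.re_add_im z]
    simp only [Matrix.add_apply, Matrix.sub_apply, Matrix.smul_apply, smul_eq_mul,
      Complex.real_smul]
    ring
  have hmem : (a + b * Complex.I : ℂ) ∈ higherRankNumericalRange k A := by
    have hc : IsClosed (higherRankNumericalRange k A) :=
      (isClosed_setOf_mem_higherRankNumericalRange n k).preimage (f := fun z => (z, A))
        (by fun_prop)
    exact hc.frontier_subset h
  obtain ⟨L, hLinj, hL⟩ := exists_isotropic_of_mem hmem
  set H₁ := H - a • (1 : Matrix (Fin n) (Fin n) ℂ) with hH₁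
  set K₁ := K - b • (1 : Matrix (Fin n) (Fin n) ℂ) with hK₁
  have hH₁h : H₁.IsHermitian := hHh.sub (hscal a)
  have hK₁h : K₁.IsHermitian := hKh.sub (hscal b)
  have hA₁ : A - (a + b * Complex.I : ℂ) • 1 = H₁ + Complex.I • K₁ := by
    rw [hshift]
    simp [hH₁, hK₁]
  have hformim : ∀ {B : Matrix (Fin n) (Fin n) ℂ}, B.IsHermitian → ∀ x : Fin n → ℂ,
      (star x ⬝ᵥ B *ᵥ x).im = 0 := by
    intro B hB x
    have h1 := star_dotProduct x (B *ᵥ x)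
    rw [star_mulVec, hB.eq, ← dotProduct_mulVec] at h1
    exact Complex.conj_eq_iff_im.1 h1.symm
  have hLHK : ∀ x, (star (L x) ⬝ᵥ H₁ *ᵥ L x).re = 0 ∧ (star (L x) ⬝ᵥ K₁ *ᵥ L x).re = 0 := by
    intro x
    have h1 := hL x
    rw [hA₁, add_mulVec, smul_mulVec, dotProduct_add, dotProduct_smul, smul_eq_mul] at h1
    have h2 := congrArg Complex.re h1
    have h3 := congrArg Complex.im h1
    simpa [hformim hH₁h, hformim hK₁h] using And.intro h2 h3
  -- Were every direction positive on some `k`-dimensional subspace, this would persist for `z` near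
  -- `a + ib`, and Li–Sze would make the point interior.
  obtain ⟨c, s, hcs, hno⟩ : ∃ c s : ℝ, (c, s) ≠ 0 ∧ ¬ HasPosSubspace (c • H₁ + s • K₁) k := by
    by_contra! hall
    have hint : (a + b * Complex.I : ℂ) ∈ interior (higherRankNumericalRange k A) := by
      rw [mem_interior_iff_mem_nhds]
      have hcont : Continuous fun z : ℂ => (H - z.re • (1 : Matrix (Fin n) (Fin n) ℂ),
          K - z.im • (1 : Matrix (Fin n) (Fin n) ℂ)) := by fun_prop
      have h1 := (isOpen_setOf_forall_hasPosSubspace n k).mem_nhds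
        (show (H₁, K₁) ∈ _ from hall)
      have h2 : (fun z : ℂ => (H - z.re • (1 : Matrix (Fin n) (Fin n) ℂ),
          K - z.im • (1 : Matrix (Fin n) (Fin n) ℂ))) (a + b * Complex.I) = (H₁, K₁) := by
        simp [hH₁, hK₁]
      rw [← h2] at h1
      filter_upwards [hcont.continuousAt.preimage_mem_nhds h1] with z hz
      rw [mem_higherRankNumericalRange_iff_zero_mem, hshift]
      exact zero_mem_of_forall_hasPosSubspace (hHh.sub (hscal _)) (hKh.sub (hscal _)) hz
    exact h.2 hint
  -- eigenvalues of the forms near `(c, s)`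
  have hLnn : ∀ x y : ℝ, ∀ v, 0 ≤ (star (L v) ⬝ᵥ (x • H₁ + y • K₁) *ᵥ L v).re := by
    intro x y v
    obtain ⟨h1, h2⟩ := hLHK v
    rw [add_mulVec, smul_mulVec, smul_mulVec, dotProduct_add, dotProduct_smul, dotProduct_smul,
      Complex.add_re, Complex.smul_re, Complex.smul_re, h1, h2]
    simp
  have hdet : ∀ x y t : ℝ, ((x • H₁ + y • K₁) - (t : ℂ) • 1).det = 0 →
      MvPolynomial.eval ![-(a * x + b * y) - t, x, y] f = 0 := by
    intro x y t h1
    refine hf _ ?_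
    rw [← h1]
    congr 1
    ext i j
    simp [hH₁, hK₁]
    ring
  -- Moving `(c, s)` by `y (w₁, w₂)` changes the form by `O(|y|)`, while it stays nonnegative on the
  -- range of `L`. The resulting eigenvalue `t` gives a zero of `f`.
  have heig : ∀ w₁ w₂ : ℝ, ∃ C : ℝ, ∀ y : ℝ, ∃ t : ℝ, 0 ≤ t ∧ t ≤ C * |y| ∧
      MvPolynomial.eval ![-(a * (c + y * w₁) + b * (s + y * w₂)) - t, c + y * w₁, s + y * w₂] f
        = 0 := by
    intro w₁ w₂
    obtain ⟨C, -, hC⟩ := exists_form_bound ((hreal w₁ hH₁h).add (hreal w₂ hK₁h))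
    refine ⟨C, fun y => ?_⟩
    obtain ⟨t, h1, h2, h3⟩ := exists_eigenvalue_mem_Icc (δ := C * |y|)
      (B := (c + y * w₁) • H₁ + (s + y * w₂) • K₁)
      ((hreal _ hH₁h).add (hreal _ hK₁h)) (fun x => by
        have h4 : (c + y * w₁) • H₁ + (s + y * w₂) • K₁ =
            (c • H₁ + s • K₁) + y • (w₁ • H₁ + w₂ • K₁) := by module
        rw [h4, add_mulVec, dotProduct_add, Complex.add_re, add_sub_cancel_left, smul_mulVec,
          dotProduct_smul, Complex.smul_re, smul_eq_mul, abs_mul]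
        calc _ ≤ |y| * (C * ∑ i, Complex.normSq (x i)) :=
              mul_le_mul_of_nonneg_left (hC x) (abs_nonneg y)
          _ = _ := by ring) L hLinj (hLnn _ _) hno
    exact ⟨t, h1, h2, hdet _ _ _ h3⟩
  set p : Fin 3 → ℝ := ![-(a * c + b * s), c, s] with hp
  have hpf : MvPolynomial.eval p f = 0 := by
    obtain ⟨C, hC⟩ := heig 0 0
    obtain ⟨t, h1, h2, h3⟩ := hC 0
    have ht : t = 0 := by
      rw [abs_zero, mul_zero] at h2
      exact le_antisymm h2 h1
    simpa [ht, hp] using h3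
  set τ := MvPolynomial.eval p (MvPolynomial.pderiv 0 f) with hτ
  have hdir : ∀ w₁ w₂ : ℝ, w₁ * (MvPolynomial.eval p (MvPolynomial.pderiv 1 f) - a * τ) +
      w₂ * (MvPolynomial.eval p (MvPolynomial.pderiv 2 f) - b * τ) = 0 := by
    intro w₁ w₂
    obtain ⟨C, hC⟩ := heig w₁ w₂
    choose l hl hlC hlf using hC
    refine directional_eq_zero (τ := τ) l hl ?_
    set u : ℝ → Fin 3 → ℝ := fun y => ![-(a * (c + y * w₁) + b * (s + y * w₂)) - l y,
      c + y * w₁, s + y * w₂] with hu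
    have hup : ∀ y, u y - p = ![-(a * w₁ + b * w₂) * y - l y, w₁ * y, w₂ * y] := by
      intro y
      ext i
      fin_cases i <;> simp [hu, hp] <;> ring
    have hlO : l =O[nhds 0] fun y => y := by
      refine Asymptotics.IsBigO.of_bound C (.of_forall fun y => ?_)
      rw [Real.norm_eq_abs, Real.norm_eq_abs, abs_of_nonneg (hl y)]
      exact hlC y
    have hlin : ∀ r : ℝ, (fun y : ℝ => r * y) =O[nhds 0] fun y => y := fun r =>
      (Asymptotics.isBigO_refl _ _).const_mul_left r
    have huO : (fun y => u y - p) =O[nhds 0] fun y => y := by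
      rw [Asymptotics.isBigO_pi]
      intro i
      simp only [hup]
      fin_cases i
      · exact (hlin _).sub hlO
      · exact hlin _
      · exact hlin _
    have hut : Filter.Tendsto u (nhds 0) (nhds p) := by
      rw [← tendsto_sub_nhds_zero_iff]
      exact huO.trans_tendsto Filter.tendsto_id
    -- As `f` vanishes at `u y` and at `p`, the derivative applied to `u y - p` is itself `o(y)`. No
    -- continuity of `l` beyond `l = O(y)` is needed.
    have h1 := ((hasFDerivAt_eval f p).isLittleO.comp_tendsto hut).trans_isBigO huO
    refine (h1.neg_left).congr_left fun y => ?_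
    have h2 : MvPolynomial.eval (u y) f = 0 := hlf y
    simp only [Function.comp_apply, h2, hpf, hup]
    simp [Fin.sum_univ_three]
    ring
  refine ⟨p, fun h0 => hcs ?_, by simp [hp], hpf, ?_, ?_⟩
  · have h1 := congrFun h0 1
    have h2 := congrFun h0 2
    simp [hp] at h1 h2
    rw [h1, h2]
    rfl
  · have := hdir 1 0
    linarith
  · have := hdir 0 1
    linarith

end Kippenhahn
end

noncomputable section

namespace Kippenhahn

open Finset

/-! ### Resultants of binary forms -/

section BinaryForms

variable {R : Type*} [CommRing R]

/-- The polynomial `G(X, 1)`. -/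
def dehomogenize (G : MvPolynomial (Fin 2) R) : Polynomial R :=
  MvPolynomial.aeval ![Polynomial.X, 1] G

theorem natDegree_dehomogenize_le {G : MvPolynomial (Fin 2) R} {e : ℕ} (hG : G.IsHomogeneous e) :
    (dehomogenize G).natDegree ≤ e := by
  rw [dehomogenize, MvPolynomial.aeval_def, MvPolynomial.eval₂_eq']
  refine Polynomial.natDegree_sum_le_of_forall_le _ _ fun m hm => ?_
  have h1 : m.degree = e := by
    by_contra h
    exact MvPolynomial.mem_support_iff.1 hm (hG.coeff_eq_zero h)
  simp only [Fin.prod_univ_two, Matrix.cons_val_zero, Matrix.cons_val_one, one_pow, mul_one]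
  refine (Polynomial.natDegree_C_mul_X_pow_le _ _).trans ?_
  rw [← h1]
  exact Finsupp.le_degree 0 m

theorem homogenize_dehomogenize {G : MvPolynomial (Fin 2) R} {e : ℕ} (hG : G.IsHomogeneous e) :
    (dehomogenize G).homogenize e = G :=
  Polynomial.homogenize_eq_of_isHomogeneous hG rfl

/-- The resultant of two binary forms of degree `e`. -/
def formResultant (e : ℕ) (G₁ G₂ : MvPolynomial (Fin 2) R) : R :=
  Polynomial.resultant (dehomogenize G₁) (dehomogenize G₂) e e

/-- The adjugate of the Sylvester matrix writes resultant times `X ^ j` as a combination of the two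
polynomials with controlled degrees; homogenizing in degree `2e - 1` gives the claim. -/
theorem resultant_mul_X_pow_mem {e : ℕ} {G₁ G₂ : MvPolynomial (Fin 2) R}
    (h₁ : G₁.IsHomogeneous e) (h₂ : G₂.IsHomogeneous e) {j : ℕ} (hj : j < e + e) :
    MvPolynomial.C (formResultant e G₁ G₂) *
      (MvPolynomial.X 0 ^ j * MvPolynomial.X 1 ^ (e + e - 1 - j)) ∈ Ideal.span {G₁, G₂} := by
  nontriviality R
  set P₁ := dehomogenize G₁
  set P₂ := dehomogenize G₂
  have hd₁ : P₁.natDegree ≤ e := natDegree_dehomogenize_le h₁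
  have hd₂ : P₂.natDegree ≤ e := natDegree_dehomogenize_le h₂
  let x : Polynomial.degreeLT R (e + e) := ⟨Polynomial.X ^ j, by
    rw [Polynomial.mem_degreeLT, Polynomial.degree_X_pow]
    exact_mod_cast hj⟩
  let z := Polynomial.adjSylvester (m := e) (n := e) P₁ P₂ x
  have hz : P₁ * (z.2 : Polynomial R) + P₂ * (z.1 : Polynomial R) =
      Polynomial.C (formResultant e G₁ G₂) * Polynomial.X ^ j := by
    have := congrArg Subtype.val
      (LinearMap.congr_fun (Polynomial.sylveserMap_comp_adjSylvester P₁ P₂ hd₁ hd₂) x)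
    rw [← Polynomial.smul_eq_C_mul]
    exact this
  have hdeg : ∀ w : Polynomial.degreeLT R e, (w : Polynomial R).natDegree ≤ e - 1 := fun w =>
    by
      rcases eq_or_ne (w : Polynomial R) 0 with h0 | h0
      · simp [h0]
      · have := (Polynomial.natDegree_lt_iff_degree_lt h0).2 (Polynomial.mem_degreeLT.1 w.2)
        omega
  have he : e + (e - 1) = e + e - 1 := by omega
  have h := congrArg (fun p => Polynomial.homogenize p (e + (e - 1))) hz
  simp only [Polynomial.homogenize_add, Polynomial.homogenize_mul _ _ hd₁ (hdeg _),
    Polynomial.homogenize_mul _ _ hd₂ (hdeg _), Polynomial.homogenize_C_mul] at h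
  rw [Polynomial.homogenize_X_pow (by omega), homogenize_dehomogenize h₁,
    homogenize_dehomogenize h₂, he] at h
  rw [← h]
  exact Ideal.add_mem _ (Ideal.mul_mem_right _ _ (Ideal.subset_span (by simp)))
    (Ideal.mul_mem_right _ _ (Ideal.subset_span (by simp)))

theorem eval₂_eq_eval_dehomogenize {K : Type*} [Field K] (φ : R →+* K) (x : K)
    (G : MvPolynomial (Fin 2) R) :
    MvPolynomial.eval₂ φ ![x, 1] G = ((dehomogenize G).map φ).eval x := by
  rw [dehomogenize, Polynomial.eval_map, MvPolynomial.aeval_def, ← Polynomial.coe_eval₂RingHom,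
    MvPolynomial.hom_eval₂]
  congr 1
  · ext r; simp
  · ext i; fin_cases i <;> simp

theorem eval₂_one_zero {K : Type*} [Field K] (φ : R →+* K) {e : ℕ}
    {G : MvPolynomial (Fin 2) R} (hG : G.IsHomogeneous e) :
    MvPolynomial.eval₂ φ ![1, 0] G = ((dehomogenize G).map φ).coeff e := by
  conv_lhs => rw [← homogenize_dehomogenize hG]
  rw [Polynomial.coeff_map]
  refine Polynomial.induction_with_natDegree_le
    (fun p => MvPolynomial.eval₂ φ ![1, 0] (p.homogenize e) = φ (p.coeff e)) e ?_ ?_ ?_ _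
    (natDegree_dehomogenize_le hG)
  · simp
  · intro n r _ hn
    rcases hn.eq_or_lt with rfl | hlt
    · simp
    · simp [Polynomial.homogenize_X_pow hn, Polynomial.coeff_X_pow, hlt.ne',
        Nat.sub_ne_zero_of_lt hlt]
  · intro p q _ _ hp hq
    simp [hp, hq]

theorem exists_root_of_not_isCoprime {K : Type*} [Field K] [IsAlgClosed K] {P Q : Polynomial K}
    (h : ¬ IsCoprime P Q) : ∃ x, P.eval x = 0 ∧ Q.eval x = 0 := by
  contrapose! h
  rw [Polynomial.isCoprime_iff_aeval_ne_zero_of_isAlgClosed K K]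
  intro x
  rw [Polynomial.coe_aeval_eq_eval]
  by_cases hx : P.eval x = 0
  · exact Or.inr (h x hx)
  · exact Or.inl hx

/-- If one specialized polynomial keeps degree `e`, vanishing of the resultant gives a common affine
root; if both drop degree, the point at infinity `[1 : 0]` is a common zero. -/
theorem exists_common_zero_of_resultant_eq_zero {K : Type*} [Field K] [IsAlgClosed K] (φ : R →+* K)
    {e : ℕ} (he : e ≠ 0) {G₁ G₂ : MvPolynomial (Fin 2) R} (h₁ : G₁.IsHomogeneous e)
    (h₂ : G₂.IsHomogeneous e) (h : φ (formResultant e G₁ G₂) = 0) :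
    ∃ x : Fin 2 → K, x ≠ 0 ∧ MvPolynomial.eval₂ φ x G₁ = 0 ∧ MvPolynomial.eval₂ φ x G₂ = 0 := by
  have aux : ∀ P Q : Polynomial K, P.natDegree = e → Q.natDegree ≤ e →
      Polynomial.resultant P Q e e = 0 → ∃ x, P.eval x = 0 ∧ Q.eval x = 0 := by
    intro P Q hP hQ hres
    obtain ⟨r, hr⟩ := Nat.exists_eq_add_of_le hQ
    have h3 : Polynomial.resultant P Q e (Q.natDegree + r) = 0 := by rw [← hr]; exact hres
    -- Passing from the formal degree `e` of `Q` to its true degree costs only a power of the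
    -- leading coefficient of `P`.
    rw [Polynomial.resultant_add_right_deg _ _ _ _ _ le_rfl, ← hP, Polynomial.coeff_natDegree] at h3
    have hP0 : P ≠ 0 := by rintro rfl; exact he (by rw [← hP]; simp)
    have h4 := (mul_eq_zero.1 h3).resolve_left
      (pow_ne_zero _ (Polynomial.leadingCoeff_ne_zero.2 hP0))
    exact exists_root_of_not_isCoprime (Polynomial.resultant_eq_zero_iff.1 h4).2
  set P₁ := (dehomogenize G₁).map φ with hP₁
  set P₂ := (dehomogenize G₂).map φ with hP₂
  have hd₁ : P₁.natDegree ≤ e := Polynomial.natDegree_map_le.trans (natDegree_dehomogenize_le h₁)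
  have hd₂ : P₂.natDegree ≤ e := Polynomial.natDegree_map_le.trans (natDegree_dehomogenize_le h₂)
  have hres : Polynomial.resultant P₁ P₂ e e = 0 := by
    rw [hP₁, hP₂, Polynomial.resultant_map_map]
    exact h
  by_cases hc₁ : P₁.natDegree = e
  · obtain ⟨x, hx₁, hx₂⟩ := aux P₁ P₂ hc₁ hd₂ hres
    exact ⟨![x, 1], fun h => one_ne_zero (congrFun h 1), by rw [eval₂_eq_eval_dehomogenize, hx₁],
      by rw [eval₂_eq_eval_dehomogenize, hx₂]⟩
  by_cases hc₂ : P₂.natDegree = e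
  · rw [Polynomial.resultant_comm] at hres
    obtain ⟨x, hx₂, hx₁⟩ := aux P₂ P₁ hc₂ hd₁ (by simpa using hres)
    exact ⟨![x, 1], fun h => one_ne_zero (congrFun h 1), by rw [eval₂_eq_eval_dehomogenize, hx₁],
      by rw [eval₂_eq_eval_dehomogenize, hx₂]⟩
  · refine ⟨![1, 0], fun h => one_ne_zero (congrFun h 0), ?_, ?_⟩
    · rw [eval₂_one_zero φ h₁]
      exact Polynomial.coeff_eq_zero_of_natDegree_lt (lt_of_le_of_ne hd₁ hc₁)
    · rw [eval₂_one_zero φ h₂]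
      exact Polynomial.coeff_eq_zero_of_natDegree_lt (lt_of_le_of_ne hd₂ hc₂)

end BinaryForms

/-! ### The conormal ideal -/

theorem mem_saturation {R : Type*} [CommRing R] {I m : Ideal R} {x : R} :
    x ∈ saturation I m ↔ ∃ N : ℕ, ∀ y ∈ m ^ N, x * y ∈ I := by
  have hmono : Monotone fun N : ℕ => Submodule.colon I ((m ^ N : Ideal R) : Set R) :=
    fun M N h => Submodule.colon_mono le_rfl (Ideal.pow_le_pow_right h)
  rw [saturation, Submodule.mem_iSup_of_directed _ hmono.directed_le]
  simp only [Submodule.mem_colon, SetLike.mem_coe, smul_eq_mul]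

/-- The hypotheses make the gradient a multiple of `(1, z 0, z 1)`, so all minors vanish. The field
is left general: it will be `ℝ` for boundary points and an algebraically closed field for generic
points of primes. -/
theorem aeval_eq_zero_of_mem_conormalIdeal {K : Type*} [Field K] [Algebra ℝ K]
    {f : MvPolynomial (Fin 3) ℝ} {q : Fin 3 → K} {z : Fin 2 → K}
    (hf : MvPolynomial.aeval q f = 0) (hline : q 0 + z 0 * q 1 + z 1 * q 2 = 0)
    (h1 : MvPolynomial.aeval q (MvPolynomial.pderiv 1 f) =
      z 0 * MvPolynomial.aeval q (MvPolynomial.pderiv 0 f))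
    (h2 : MvPolynomial.aeval q (MvPolynomial.pderiv 2 f) =
      z 1 * MvPolynomial.aeval q (MvPolynomial.pderiv 0 f))
    {x : MvPolynomial (Fin 3 ⊕ Fin 2) ℝ} (hx : x ∈ conormalIdeal f) :
    MvPolynomial.aeval (Sum.elim q z) x = 0 := by
  have hren : ∀ h : MvPolynomial (Fin 3) ℝ,
      MvPolynomial.aeval (Sum.elim q z) (MvPolynomial.rename Sum.inl h) =
        MvPolynomial.aeval q h := fun h => by rw [MvPolynomial.aeval_rename]; rfl
  have hle : conormalIdeal f ≤ RingHom.ker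
      (MvPolynomial.aeval (R := ℝ) (Sum.elim q z)).toRingHom := by
    refine sup_le (Ideal.span_le.2 ?_) (Ideal.span_le.2 ?_)
    · rintro _ (rfl | rfl)
      · exact (hren f).trans hf
      · show MvPolynomial.aeval (Sum.elim q z) _ = 0
        simpa [Fin.sum_univ_three, dualRow] using hline
    · rintro _ ⟨⟨i, j⟩, rfl⟩
      show MvPolynomial.aeval (Sum.elim q z) _ = 0
      have h3 : ∀ i, MvPolynomial.aeval q (MvPolynomial.pderiv i f) =
          MvPolynomial.aeval (Sum.elim q z) (dualRow i) *
            MvPolynomial.aeval q (MvPolynomial.pderiv 0 f) := by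
        intro i
        fin_cases i <;> simp [dualRow, h1, h2]
      simp only [Matrix.det_fin_two, Matrix.submatrix_apply, tangencyMatrix, Matrix.of_apply, id,
        Matrix.cons_val_zero, Matrix.cons_val_one, map_sub, map_mul, hren]
      rw [h3 i, h3 j]
      ring
  exact hle hx

/-- Elements of the eliminated ideal vanish at the dual points of the tangent lines and on the dual
lines of the singular points. -/
theorem aeval_eq_zero_of_mem_saturation {K : Type*} [Field K] [Algebra ℝ K]
    {f : MvPolynomial (Fin 3) ℝ} {q : Fin 3 → K} {z : Fin 2 → K} (hq : q ≠ 0)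
    (hf : MvPolynomial.aeval q f = 0) (hline : q 0 + z 0 * q 1 + z 1 * q 2 = 0)
    (h1 : MvPolynomial.aeval q (MvPolynomial.pderiv 1 f) =
      z 0 * MvPolynomial.aeval q (MvPolynomial.pderiv 0 f))
    (h2 : MvPolynomial.aeval q (MvPolynomial.pderiv 2 f) =
      z 1 * MvPolynomial.aeval q (MvPolynomial.pderiv 0 f))
    {r : MvPolynomial (Fin 2) ℝ}
    (hr : MvPolynomial.rename Sum.inr r ∈ saturation (conormalIdeal f) irrelevantIdeal) :
    MvPolynomial.aeval z r = 0 := by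
  obtain ⟨N, hN⟩ := mem_saturation.1 hr
  obtain ⟨i, hi⟩ := Function.ne_iff.1 hq
  have h3 := aeval_eq_zero_of_mem_conormalIdeal hf hline h1 h2
    (hN (MvPolynomial.X (Sum.inl i) ^ N)
      (Ideal.pow_mem_pow (Ideal.subset_span (Set.mem_range_self i)) N))
  rw [map_mul, map_pow, MvPolynomial.aeval_X, MvPolynomial.aeval_rename] at h3
  exact (mul_eq_zero.1 h3).resolve_right (pow_ne_zero _ hi)

/-! ### Elimination by the discriminant of the restriction to a line -/

/-- The general point `(-(a x + b y), x, y)` of the line `t + a x + b y = 0`. -/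
def linePoint : Fin 3 → MvPolynomial (Fin 2) (MvPolynomial (Fin 2) ℝ) :=
  ![-(MvPolynomial.C (MvPolynomial.X 0) * MvPolynomial.X 0 +
    MvPolynomial.C (MvPolynomial.X 1) * MvPolynomial.X 1), MvPolynomial.X 0, MvPolynomial.X 1]

/-- The form `∂f/∂x_i - z ∂f/∂t` restricted to the line `t + a x + b y = 0`, as a binary form in
`x, y` over `ℝ[a, b]`. -/
def lineForm (f : MvPolynomial (Fin 3) ℝ) (i : Fin 2) :
    MvPolynomial (Fin 2) (MvPolynomial (Fin 2) ℝ) :=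
  MvPolynomial.aeval (linePoint) (MvPolynomial.pderiv i.succ f) -
    MvPolynomial.C (MvPolynomial.X i) * MvPolynomial.aeval linePoint (MvPolynomial.pderiv 0 f)

theorem isHomogeneous_lineForm {f : MvPolynomial (Fin 3) ℝ} {d : ℕ} (hf : f.IsHomogeneous d)
    (i : Fin 2) : (lineForm f i).IsHomogeneous (d - 1) := by
  have h : ∀ j, (linePoint j).IsHomogeneous 1 := by
    intro j
    fin_cases j
    · exact ((MvPolynomial.isHomogeneous_C_mul_X _ _).add
        (MvPolynomial.isHomogeneous_C_mul_X _ _)).neg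
    · exact MvPolynomial.isHomogeneous_X _ _
    · exact MvPolynomial.isHomogeneous_X _ _
  have h2 : ∀ j, (MvPolynomial.aeval linePoint (MvPolynomial.pderiv j f)).IsHomogeneous (d - 1) :=
    fun j => by simpa using (hf.pderiv (i := j)).aeval linePoint h
  exact (h2 _).sub ((h2 _).C_mul _)

theorem eval₂_lineForm {S : Type*} [CommRing S] [Algebra ℝ S] (f : MvPolynomial (Fin 3) ℝ)
    (i : Fin 2) (z : Fin 2 → S) (x : Fin 2 → S) :
    MvPolynomial.eval₂ (MvPolynomial.aeval z : MvPolynomial (Fin 2) ℝ →ₐ[ℝ] S).toRingHom x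
      (lineForm f i) =
      MvPolynomial.aeval ![-(z 0 * x 0 + z 1 * x 1), x 0, x 1] (MvPolynomial.pderiv i.succ f) -
        z i * MvPolynomial.aeval ![-(z 0 * x 0 + z 1 * x 1), x 0, x 1]
          (MvPolynomial.pderiv 0 f) := by
  have h : ∀ g : MvPolynomial (Fin 3) ℝ,
      MvPolynomial.eval₂ (MvPolynomial.aeval z : MvPolynomial (Fin 2) ℝ →ₐ[ℝ] S).toRingHom x
        (MvPolynomial.aeval linePoint g) =
      MvPolynomial.aeval ![-(z 0 * x 0 + z 1 * x 1), x 0, x 1] g := by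
    intro g
    rw [MvPolynomial.aeval_def, ← MvPolynomial.coe_eval₂Hom, MvPolynomial.hom_eval₂,
      MvPolynomial.aeval_def]
    congr 1
    · ext r
      rw [RingHom.comp_apply, IsScalarTower.algebraMap_apply ℝ (MvPolynomial (Fin 2) ℝ),
        MvPolynomial.algebraMap_eq, MvPolynomial.algebraMap_eq, MvPolynomial.coe_eval₂Hom,
        MvPolynomial.eval₂_C]
      exact MvPolynomial.aeval_C z r
    · ext j
      fin_cases j <;> simp [linePoint]
  rw [lineForm, MvPolynomial.eval₂_sub, MvPolynomial.eval₂_mul, h, h]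
  simp

/-- The discriminant of the restriction of `f` to the line `t + a x + b y = 0`. -/
def lineDiscriminant (f : MvPolynomial (Fin 3) ℝ) (d : ℕ) : MvPolynomial (Fin 2) ℝ :=
  formResultant (d - 1) (lineForm f 0) (lineForm f 1)

/-- Modulo the conormal ideal `t = -(ax + by)` and both line forms vanish, so the resultant kills a
power of `x` and a power of `y`. As `t` is a combination of `x` and `y`, it kills a power of the
irrelevant ideal. -/
theorem lineDiscriminant_mem_saturation {f : MvPolynomial (Fin 3) ℝ} {d : ℕ}
    (hf : f.IsHomogeneous d) (hd : 2 ≤ d) :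
    MvPolynomial.rename Sum.inr (lineDiscriminant f d) ∈
      saturation (conormalIdeal f) irrelevantIdeal := by
  set I := conormalIdeal f with hI
  let S := MvPolynomial (Fin 3 ⊕ Fin 2) ℝ ⧸ I
  let π : MvPolynomial (Fin 3 ⊕ Fin 2) ℝ →ₐ[ℝ] S := Ideal.Quotient.mkₐ ℝ I
  let v : Fin 3 → S := fun i => π (MvPolynomial.X (Sum.inl i))
  let z : Fin 2 → S := fun i => π (MvPolynomial.X (Sum.inr i))
  have hπ0 : ∀ {y}, y ∈ I → π y = 0 := fun hy => Ideal.Quotient.eq_zero_iff_mem.2 hy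
  have hline : v 0 + z 0 * v 1 + z 1 * v 2 = 0 := by
    have := hπ0 (y := ∑ i, dualRow i * MvPolynomial.X (Sum.inl i))
      (Ideal.mem_sup_left (Ideal.subset_span (by simp)))
    simpa [Fin.sum_univ_three, dualRow] using this
  have hv : ![-(z 0 * v 1 + z 1 * v 2), v 1, v 2] = v := by
    ext i
    fin_cases i
    · show -(z 0 * v 1 + z 1 * v 2) = v 0
      linear_combination -hline
    · rfl
    · rfl
  have hπv : ∀ g, MvPolynomial.aeval v g = π (MvPolynomial.rename Sum.inl g) := by
    intro g
    rw [← AlgHom.comp_apply]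
    congr 1
    ext i
    simp [v]
  have hminor : ∀ i : Fin 2, MvPolynomial.aeval v (MvPolynomial.pderiv i.succ f) -
      z i * MvPolynomial.aeval v (MvPolynomial.pderiv 0 f) = 0 := by
    intro i
    have := hπ0 (y := ((tangencyMatrix f).submatrix id ![0, i.succ]).det)
      (Ideal.mem_sup_right (Ideal.subset_span ⟨(0, i.succ), rfl⟩))
    rw [hπv, hπv]
    fin_cases i <;> simpa [Matrix.det_fin_two, tangencyMatrix, dualRow] using this
  let Ψ : MvPolynomial (Fin 2) (MvPolynomial (Fin 2) ℝ) →+* S :=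
    MvPolynomial.eval₂Hom (MvPolynomial.aeval z : MvPolynomial (Fin 2) ℝ →ₐ[ℝ] S).toRingHom
      ![v 1, v 2]
  have hΨ : ∀ i, Ψ (lineForm f i) = 0 := by
    intro i
    have := eval₂_lineForm f i z ![v 1, v 2]
    simp only [Matrix.cons_val_zero, Matrix.cons_val_one, hv] at this
    exact this.trans (hminor i)
  have hker : Ideal.span {lineForm f 0, lineForm f 1} ≤ RingHom.ker Ψ := by
    rw [Ideal.span_le]
    rintro _ (rfl | rfl)
    · exact hΨ 0
    · exact hΨ 1
  set ρ := MvPolynomial.rename (Sum.inr : Fin 2 → Fin 3 ⊕ Fin 2) (lineDiscriminant f d) with hρ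
  have hπρ : π ρ = MvPolynomial.aeval z (lineDiscriminant f d) := by
    rw [hρ, ← AlgHom.comp_apply]
    congr 1
    ext i
    simp [z]
  have hmem : ∀ j < (d - 1) + (d - 1),
      π ρ * (v 1 ^ j * v 2 ^ ((d - 1) + (d - 1) - 1 - j)) = 0 := by
    intro j hj
    have h1 := hker (resultant_mul_X_pow_mem (isHomogeneous_lineForm hf 0)
      (isHomogeneous_lineForm hf 1) hj)
    rw [RingHom.mem_ker, map_mul, map_mul, map_pow, map_pow] at h1
    simpa [Ψ, hπρ, lineDiscriminant] using h1
  set M := (d - 1) + (d - 1) - 1 with hM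
  let I' : Ideal (MvPolynomial (Fin 3 ⊕ Fin 2) ℝ) := Submodule.colon I {ρ}
  have hI' : ∀ y, y ∈ I' ↔ y * ρ ∈ I := fun y => Submodule.mem_colon_singleton
  have hx : (MvPolynomial.X (Sum.inl 1) : MvPolynomial (Fin 3 ⊕ Fin 2) ℝ) ∈ I'.radical := by
    refine ⟨M, (hI' _).2 (Ideal.Quotient.eq_zero_iff_mem.1 ?_)⟩
    have h := hmem M (by omega)
    rw [Nat.sub_self, pow_zero, mul_one, mul_comm] at h
    exact (map_mul π _ _).trans ((congrArg (· * π ρ) (map_pow π _ _)).trans h)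
  have hy : (MvPolynomial.X (Sum.inl 2) : MvPolynomial (Fin 3 ⊕ Fin 2) ℝ) ∈ I'.radical := by
    refine ⟨M, (hI' _).2 (Ideal.Quotient.eq_zero_iff_mem.1 ?_)⟩
    have h := hmem 0 (by omega)
    rw [Nat.sub_zero, pow_zero, one_mul, mul_comm] at h
    exact (map_mul π _ _).trans ((congrArg (· * π ρ) (map_pow π _ _)).trans h)
  have ht : (MvPolynomial.X (Sum.inl 0) : MvPolynomial (Fin 3 ⊕ Fin 2) ℝ) ∈ I'.radical := by
    have h : ∑ i, dualRow i * MvPolynomial.X (Sum.inl i) ∈ I'.radical :=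
      Ideal.le_radical ((hI' _).2 (Ideal.mul_mem_right _ _
        (Ideal.mem_sup_left (Ideal.subset_span (by simp)))))
    have h2 := Ideal.sub_mem _ (Ideal.sub_mem _ h (Ideal.mul_mem_left _ (dualRow 1) hx))
      (Ideal.mul_mem_left _ (dualRow 2) hy)
    convert h2 using 1
    simp only [Fin.sum_univ_three, dualRow, Matrix.cons_val]
    ring
  have hle : irrelevantIdeal ≤ I'.radical := by
    rw [irrelevantIdeal, Ideal.span_le]
    rintro _ ⟨i, rfl⟩
    fin_cases i
    · exact ht
    · exact hx
    · exact hy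
  obtain ⟨N, hN⟩ := Ideal.exists_pow_le_of_le_radical_of_fg hle
    (Submodule.fg_span (Set.finite_range _))
  refine mem_saturation.2 ⟨N, fun y hy => ?_⟩
  rw [mul_comm]
  exact (hI' y).1 (hN hy)

/-- Let a prime `𝔭` contain the discriminant. Over an algebraic closure of its residue field the two
line forms acquire a common zero, which is a tangency point over the generic point of `𝔭`; hence `r`
vanishes there, that is, `r ∈ 𝔭`. -/
theorem mem_radical_span_lineDiscriminant {f : MvPolynomial (Fin 3) ℝ} {d : ℕ}
    (hf : f.IsHomogeneous d) (hd : 2 ≤ d) {r : MvPolynomial (Fin 2) ℝ}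
    (hr : MvPolynomial.rename Sum.inr r ∈ saturation (conormalIdeal f) irrelevantIdeal) :
    r ∈ (Ideal.span {lineDiscriminant f d}).radical := by
  rw [Ideal.radical_eq_sInf, Ideal.mem_sInf]
  rintro 𝔭 ⟨h𝔭, hprime⟩
  have hρ : lineDiscriminant f d ∈ 𝔭 := h𝔭 (Ideal.mem_span_singleton_self _)
  let K := AlgebraicClosure (FractionRing (MvPolynomial (Fin 2) ℝ ⧸ 𝔭))
  let ι : MvPolynomial (Fin 2) ℝ ⧸ 𝔭 →ₐ[ℝ] K := IsScalarTower.toAlgHom ℝ _ K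
  have hι : Function.Injective ι := by
    have h := (algebraMap (FractionRing (MvPolynomial (Fin 2) ℝ ⧸ 𝔭)) K).injective.comp
      (IsFractionRing.injective (MvPolynomial (Fin 2) ℝ ⧸ 𝔭)
        (FractionRing (MvPolynomial (Fin 2) ℝ ⧸ 𝔭)))
    rwa [← RingHom.coe_comp, ← IsScalarTower.algebraMap_eq] at h
  let π : MvPolynomial (Fin 2) ℝ →ₐ[ℝ] K := ι.comp (Ideal.Quotient.mkₐ ℝ 𝔭)
  let z : Fin 2 → K := fun i => π (MvPolynomial.X i)
  have hz : MvPolynomial.aeval z = π := by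
    ext i
    simp [z]
  have hker : ∀ g, MvPolynomial.aeval z g = 0 ↔ g ∈ 𝔭 := by
    intro g
    rw [hz, ← Ideal.Quotient.eq_zero_iff_mem]
    exact map_eq_zero_iff ι hι
  obtain ⟨x, hx, h0, h1⟩ := exists_common_zero_of_resultant_eq_zero
    (MvPolynomial.aeval z : MvPolynomial (Fin 2) ℝ →ₐ[ℝ] K).toRingHom
    (e := d - 1) (by omega) (isHomogeneous_lineForm hf 0) (isHomogeneous_lineForm hf 1)
    ((hker _).2 hρ)
  rw [eval₂_lineForm, sub_eq_zero] at h0 h1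
  set q : Fin 3 → K := ![-(z 0 * x 0 + z 1 * x 1), x 0, x 1] with hq
  have hline : q 0 + z 0 * q 1 + z 1 * q 2 = 0 := by
    simp only [hq, Matrix.cons_val]
    ring
  refine (hker r).1 (aeval_eq_zero_of_mem_saturation (f := f) (q := q) ?_ ?_ hline h0 h1 hr)
  · intro h
    apply hx
    ext i
    fin_cases i
    · exact congrFun h 1
    · exact congrFun h 2
  -- Euler's relation: the gradient is proportional to `(1, z 0, z 1)` and `q` is on the line, so `d
  -- * f(q) = 0`.
  · have h := congrArg (MvPolynomial.aeval q) hf.sum_X_mul_pderiv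
    rw [map_nsmul, map_sum, Fin.sum_univ_three, map_mul, map_mul, map_mul, MvPolynomial.aeval_X,
      MvPolynomial.aeval_X, MvPolynomial.aeval_X] at h
    change _ + _ * MvPolynomial.aeval q (MvPolynomial.pderiv (Fin.succ 0) f) +
      _ * MvPolynomial.aeval q (MvPolynomial.pderiv (Fin.succ 1) f) = _ at h
    rw [h0, h1] at h
    have : CharZero K := algebraRat.charZero K
    have h3 : (d : K) * MvPolynomial.aeval q f = 0 := by
      rw [← nsmul_eq_mul, ← h]
      linear_combination MvPolynomial.aeval q (MvPolynomial.pderiv 0 f) * hline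
    exact (mul_eq_zero.1 h3).resolve_left (Nat.cast_ne_zero.2 (by omega))

theorem radical_comap_saturation_eq {f : MvPolynomial (Fin 3) ℝ} {d : ℕ}
    (hf : f.IsHomogeneous d) (hd : 2 ≤ d) :
    (Ideal.comap (MvPolynomial.rename (R := ℝ) (Sum.inr : Fin 2 → Fin 3 ⊕ Fin 2))
      (saturation (conormalIdeal f) irrelevantIdeal)).radical =
      (Ideal.span {lineDiscriminant f d}).radical := by
  apply le_antisymm
  · rw [← Ideal.radical_idem (Ideal.span _)]
    exact Ideal.radical_mono fun r hr => mem_radical_span_lineDiscriminant hf hd hr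
  · refine Ideal.radical_mono ((Ideal.span_singleton_le_iff_mem _).2 ?_)
    exact lineDiscriminant_mem_saturation hf hd

theorem exists_radical_span_singleton_eq {R : Type*} [CommRing R] [IsDomain R]
    [UniqueFactorizationMonoid R] (ρ : R) : ∃ g, (Ideal.span {ρ}).radical = Ideal.span {g} := by
  let : StrongNormalizationMonoid R := UniqueFactorizationMonoid.strongNormalizationMonoid
  rcases eq_or_ne ρ 0 with rfl | hρ
  · refine ⟨0, ?_⟩
    rw [Ideal.span_singleton_zero]
    exact Ideal.radical_bot_of_isReduced
  · refine ⟨UniqueFactorizationMonoid.radical ρ, Ideal.ext fun x => ?_⟩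
    simp only [Ideal.mem_radical_iff, Ideal.mem_span_singleton]
    exact UniqueFactorizationMonoid.exists_dvd_pow_iff_radical_dvd hρ

end Kippenhahn
end

noncomputable section

namespace Kippenhahn

open Finset

/-! ### Divisors of homogeneous polynomials -/

section Homogeneous

variable {σ R : Type*} [CommRing R]

/-- The substitution `X_i ↦ X_i T`. -/
def scaleVars : MvPolynomial σ R →ₐ[R] Polynomial (MvPolynomial σ R) :=
  MvPolynomial.aeval fun i => Polynomial.C (MvPolynomial.X i) * Polynomial.X

theorem scaleVars_monomial (m : σ →₀ ℕ) (r : R) :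
    scaleVars (MvPolynomial.monomial m r) =
      Polynomial.monomial m.degree (MvPolynomial.monomial m r) := by
  rw [scaleVars, MvPolynomial.aeval_monomial, Finsupp.prod, ← Polynomial.C_mul_X_pow_eq_monomial,
    MvPolynomial.monomial_eq, Finsupp.prod, Finsupp.degree]
  simp only [mul_pow, Finset.prod_mul_distrib, Finset.prod_pow_eq_pow_sum, map_mul, map_prod,
    map_pow]
  rw [← mul_assoc]
  rfl

theorem coeff_scaleVars (p : MvPolynomial σ R) (m : σ →₀ ℕ) :
    MvPolynomial.coeff m ((scaleVars p).coeff m.degree) = MvPolynomial.coeff m p := by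
  classical
  induction p using MvPolynomial.induction_on' with
  | monomial u a =>
    rw [scaleVars_monomial, Polynomial.coeff_monomial]
    split_ifs with h
    · rfl
    · rw [MvPolynomial.coeff_zero, MvPolynomial.coeff_monomial, if_neg]
      rintro rfl
      exact h rfl
  | add p q hp hq => rw [map_add, Polynomial.coeff_add, MvPolynomial.coeff_add, hp, hq,
      MvPolynomial.coeff_add]

theorem scaleVars_of_isHomogeneous {p : MvPolynomial σ R} {n : ℕ} (hp : p.IsHomogeneous n) :
    scaleVars p = Polynomial.monomial n p := by
  conv_lhs => rw [p.as_sum]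
  conv_rhs => rw [p.as_sum]
  rw [map_sum, map_sum]
  refine Finset.sum_congr rfl fun m hm => ?_
  have h : m.degree = n := by
    by_contra h
    exact MvPolynomial.mem_support_iff.1 hm (hp.coeff_eq_zero h)
  rw [scaleVars_monomial, h]

/-- Under `X_i ↦ X_i T` a homogeneous polynomial becomes a monomial in `T`. Degree and trailing
degree in `T` add under products, so each factor of a monomial is a monomial. -/
theorem exists_isHomogeneous_of_dvd [IsDomain R] {p h : MvPolynomial σ R} {n : ℕ}
    (hh : h.IsHomogeneous n) (h0 : h ≠ 0) (hp : p ∣ h) : ∃ d, p.IsHomogeneous d := by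
  obtain ⟨q, rfl⟩ := hp
  have key := scaleVars_of_isHomogeneous hh
  rw [map_mul] at key
  have hne : scaleVars p * scaleVars q ≠ 0 := by
    rw [key]
    exact fun h => h0 (Polynomial.monomial_eq_zero_iff _ _ |>.1 h)
  have hp0 := left_ne_zero_of_mul hne
  have hq0 := right_ne_zero_of_mul hne
  have h1 := Polynomial.natDegree_mul hp0 hq0
  have h2 := Polynomial.natTrailingDegree_mul hp0 hq0
  rw [key, Polynomial.natDegree_monomial_eq _ h0] at h1
  rw [key, Polynomial.natTrailingDegree_monomial h0] at h2
  have h3 := Polynomial.natTrailingDegree_le_natDegree (scaleVars p)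
  have h4 := Polynomial.natTrailingDegree_le_natDegree (scaleVars q)
  refine ⟨(scaleVars p).natDegree, fun m hm => ?_⟩
  have hc : (scaleVars p).coeff m.degree ≠ 0 := by
    intro h
    rw [← coeff_scaleVars, h, MvPolynomial.coeff_zero] at hm
    exact hm rfl
  have h5 := Polynomial.le_natDegree_of_ne_zero hc
  have h6 := Polynomial.natTrailingDegree_le_of_ne_zero hc
  have h7 : (Finsupp.weight 1) m = m.degree := by
    rw [Finsupp.degree_eq_weight_one]
    rfl
  omega

end Homogeneous

/-! ### The Kippenhahn polynomial -/

variable {n : ℕ}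

theorem ofReal_eval_kippenhahnPoly (A : Matrix (Fin n) (Fin n) ℂ) (v : Fin 3 → ℝ) :
    ((MvPolynomial.eval v (kippenhahnPoly A) : ℝ) : ℂ) =
      ((v 0 : ℂ) • (1 : Matrix (Fin n) (Fin n) ℂ) + (v 1 : ℂ) • (ℜ A : Matrix (Fin n) (Fin n) ℂ) +
        (v 2 : ℂ) • (ℑ A : Matrix (Fin n) (Fin n) ℂ)).det := by
  have h1 : ((MvPolynomial.eval v (kippenhahnPoly A) : ℝ) : ℂ) =
      MvPolynomial.eval (fun i => (v i : ℂ)) (pencil A).det := by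
    rw [← map_kippenhahnPoly, MvPolynomial.eval_map]
    exact MvPolynomial.hom_eval₂ _ (RingHom.id ℝ) Complex.ofRealHom v
  rw [h1, RingHom.map_det]
  congr 1
  ext i j
  simp [pencil, Matrix.one_apply, apply_ite]

theorem isHomogeneous_kippenhahnPoly (A : Matrix (Fin n) (Fin n) ℂ) :
    (kippenhahnPoly A).IsHomogeneous n := by
  apply MvPolynomial.IsHomogeneous.of_map (f := algebraMap ℝ ℂ) (algebraMap ℝ ℂ).injective
  rw [map_kippenhahnPoly, Matrix.det_apply]
  refine MvPolynomial.IsHomogeneous.sum _ _ _ fun s _ => ?_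
  have hentry : ∀ i j, (pencil A i j).IsHomogeneous 1 := by
    intro i j
    have h : ∀ (k : Fin 3) (c : ℂ),
        (MvPolynomial.X k * MvPolynomial.C c : MvPolynomial (Fin 3) ℂ).IsHomogeneous 1 :=
      fun k c => by
        rw [mul_comm]
        exact MvPolynomial.isHomogeneous_C_mul_X _ _
    have h0 := h 0 ((1 : Matrix (Fin n) (Fin n) ℂ) i j)
    rw [Matrix.one_apply, apply_ite MvPolynomial.C, map_one, map_zero, ← Matrix.one_apply] at h0
    exact (h0.add (h 1 _)).add (h 2 _)
  have hprod := MvPolynomial.IsHomogeneous.prod Finset.univ (fun i => pencil A (s i) i)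
    (fun _ => 1) fun i _ => hentry _ _
  rw [Finset.sum_const, Finset.card_univ, Fintype.card_fin, smul_eq_mul, mul_one] at hprod
  rcases Int.units_eq_one_or (Equiv.Perm.sign s) with h | h <;> rw [h]
  · simpa using hprod
  · simpa using hprod.neg

theorem eval_kippenhahnPoly_e0 (A : Matrix (Fin n) (Fin n) ℂ) :
    MvPolynomial.eval ![1, 0, 0] (kippenhahnPoly A) = 1 := by
  have h := ofReal_eval_kippenhahnPoly A ![1, 0, 0]
  simp only [Matrix.cons_val, Complex.ofReal_one, Complex.ofReal_zero, zero_smul, add_zero,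
    one_smul, Matrix.det_one] at h
  exact_mod_cast h

theorem kippenhahnPoly_ne_zero (A : Matrix (Fin n) (Fin n) ℂ) : kippenhahnPoly A ≠ 0 := by
  intro h
  have := eval_kippenhahnPoly_e0 A
  rw [h, map_zero] at this
  exact zero_ne_one this

/-! ### The square-free part of the Kippenhahn polynomial -/

theorem squarefreePart_dvd (f : MvPolynomial (Fin 3) ℝ) : squarefreePart f ∣ f :=
  let : StrongNormalizationMonoid (MvPolynomial (Fin 3) ℝ) :=
    UniqueFactorizationMonoid.strongNormalizationMonoid
  UniqueFactorizationMonoid.radical_dvd_self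

theorem exists_dvd_squarefreePart_pow {f : MvPolynomial (Fin 3) ℝ} (hf : f ≠ 0) :
    ∃ m, f ∣ squarefreePart f ^ m :=
  let : StrongNormalizationMonoid (MvPolynomial (Fin 3) ℝ) :=
    UniqueFactorizationMonoid.strongNormalizationMonoid
  UniqueFactorizationMonoid.exists_dvd_radical_self_pow hf

theorem eval_squarefreePart_eq_zero {f : MvPolynomial (Fin 3) ℝ} (hf : f ≠ 0) {v : Fin 3 → ℝ}
    (hv : MvPolynomial.eval v f = 0) : MvPolynomial.eval v (squarefreePart f) = 0 := by
  obtain ⟨m, c, hm⟩ := exists_dvd_squarefreePart_pow hf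
  have := congrArg (MvPolynomial.eval v) hm
  rw [map_pow, map_mul, hv, zero_mul] at this
  exact eq_zero_of_pow_eq_zero this

/-- A nonzero linear form is prime, so `f` is a constant times `l ^ j`. A real constant need not be
a `j`-th power; the value `1` at `(1, 0, 0)` shows that this one is `s⁻¹ ^ j` when `j > 0`. -/
theorem isPowerOfLinearForm_of_dvd_pow {f l : MvPolynomial (Fin 3) ℝ}
    (hf : MvPolynomial.eval ![1, 0, 0] f = 1) (hl : l.IsHomogeneous 1) (hl0 : l ≠ 0) {m : ℕ}
    (h : f ∣ l ^ m) : IsPowerOfLinearForm f := by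
  have hdeg : l.totalDegree = 1 := hl.totalDegree hl0
  have hirr : Irreducible l := by
    refine MvPolynomial.irreducible_of_totalDegree_eq_one hdeg fun x hx => ?_
    obtain ⟨i, hi⟩ := MvPolynomial.ne_zero_iff.1 hl0
    exact (ne_zero_of_dvd_ne_zero hi (hx i)).isUnit
  obtain ⟨j, -, hj⟩ := (dvd_prime_pow hirr.prime m).1 h
  obtain ⟨u, hu⟩ := hj.symm
  obtain ⟨c, hc, hcu⟩ := MvPolynomial.isUnit_iff_eq_C_of_isReduced.1 u.isUnit
  rw [hcu] at hu
  have h1 := congrArg (MvPolynomial.eval ![1, 0, 0]) hu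
  rw [map_mul, map_pow, MvPolynomial.eval_C, hf] at h1
  set s := MvPolynomial.eval ![1, 0, 0] l
  rcases Nat.eq_zero_or_pos j with rfl | hjpos
  · refine ⟨l, 0, hl, ?_⟩
    rw [pow_zero, one_mul] at h1
    rw [← hu, h1, map_one, mul_one]
  · refine ⟨MvPolynomial.C s⁻¹ * l, j, hl.C_mul _, ?_⟩
    rw [mul_pow, ← map_pow, ← hu, mul_comm, inv_pow]
    congr 2
    exact eq_inv_of_mul_eq_one_right h1

/-- Degree `0` would make `f_A` the constant `1`, and degree `1` would make it divide a power of a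
linear form; both are excluded by `hA`. -/
theorem exists_isHomogeneous_squarefreePart (A : Matrix (Fin n) (Fin n) ℂ)
    (hA : ¬ IsPowerOfLinearForm (kippenhahnPoly A)) :
    ∃ d, 2 ≤ d ∧ (squarefreePart (kippenhahnPoly A)).IsHomogeneous d := by
  have hf0 := kippenhahnPoly_ne_zero A
  have hr0 : squarefreePart (kippenhahnPoly A) ≠ 0 :=
    ne_zero_of_dvd_ne_zero hf0 (squarefreePart_dvd _)
  obtain ⟨d, hd⟩ := exists_isHomogeneous_of_dvd (isHomogeneous_kippenhahnPoly A) hf0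
    (squarefreePart_dvd _)
  obtain ⟨m, hm⟩ := exists_dvd_squarefreePart_pow hf0
  refine ⟨d, ?_, hd⟩
  by_contra! hlt
  interval_cases d
  · have hunit : IsUnit (kippenhahnPoly A) := by
      refine isUnit_of_dvd_unit hm (IsUnit.pow _ ?_)
      rw [MvPolynomial.isUnit_iff_totalDegree_of_isReduced, hd.totalDegree hr0]
      refine ⟨isUnit_iff_ne_zero.2 fun h => hr0 ?_, rfl⟩
      rw [MvPolynomial.totalDegree_eq_zero_iff_eq_C.1 (hd.totalDegree hr0), h, map_zero]
    obtain ⟨c, hc, hcA⟩ := MvPolynomial.isUnit_iff_eq_C_of_isReduced.1 hunit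
    have h1 := eval_kippenhahnPoly_e0 A
    rw [hcA, MvPolynomial.eval_C] at h1
    exact hA ⟨MvPolynomial.X 0, 0, MvPolynomial.isHomogeneous_X _ _, by simp [hcA, h1]⟩
  · exact hA (isPowerOfLinearForm_of_dvd_pow (eval_kippenhahnPoly_e0 A) hd hr0 hm)

/-- A boundary point of `Λ_k(A)` is dual to a tangent line, or on the dual line of a real singular
point, of the reduced Kippenhahn curve. -/
theorem exists_tangent_point_squarefreePart {k : ℕ} {A : Matrix (Fin n) (Fin n) ℂ} {a b : ℝ}
    (h : (a + b * Complex.I : ℂ) ∈ frontier (higherRankNumericalRange k A)) :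
    ∃ p : Fin 3 → ℝ, p ≠ 0 ∧ p 0 + a * p 1 + b * p 2 = 0 ∧
      MvPolynomial.eval p (squarefreePart (kippenhahnPoly A)) = 0 ∧
      MvPolynomial.eval p (MvPolynomial.pderiv 1 (squarefreePart (kippenhahnPoly A))) =
        a * MvPolynomial.eval p (MvPolynomial.pderiv 0 (squarefreePart (kippenhahnPoly A))) ∧
      MvPolynomial.eval p (MvPolynomial.pderiv 2 (squarefreePart (kippenhahnPoly A))) =
        b * MvPolynomial.eval p (MvPolynomial.pderiv 0 (squarefreePart (kippenhahnPoly A))) := by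
  refine exists_tangent_point h _ fun v hv => ?_
  refine eval_squarefreePart_eq_zero (kippenhahnPoly_ne_zero A) ?_
  rw [← ofReal_eval_kippenhahnPoly] at hv
  exact_mod_cast hv

/-! ### From tangent points to the assertions of the theorem -/

theorem eval_eq_zero_of_mem_boundaryIdeal {k : ℕ} {A : Matrix (Fin n) (Fin n) ℂ} {a b : ℝ}
    (h : (a + b * Complex.I : ℂ) ∈ frontier (higherRankNumericalRange k A))
    {g : MvPolynomial (Fin 2) ℝ} (hg : g ∈ boundaryIdeal A) :
    MvPolynomial.eval ![a, b] g = 0 := by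
  obtain ⟨p, hp0, hline, hf, h1, h2⟩ := exists_tangent_point_squarefreePart h
  obtain ⟨m, hm⟩ := hg
  simp only [← MvPolynomial.coe_aeval_eq_eval, RingHom.coe_coe] at hf h1 h2 ⊢
  have := aeval_eq_zero_of_mem_saturation (z := ![a, b]) hp0 hf hline h1 h2 hm
  rw [map_pow] at this
  exact eq_zero_of_pow_eq_zero this

/-- Needed because the chosen representative of a projective point is an unspecified complex
multiple of the real vector `p`. -/
theorem aeval_smul_of_isHomogeneous {f : MvPolynomial (Fin 3) ℝ} {d : ℕ} (hf : f.IsHomogeneous d)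
    (c : ℂ) (p : Fin 3 → ℝ) :
    MvPolynomial.aeval (c • fun i => (p i : ℂ)) f = c ^ d * (MvPolynomial.eval p f : ℝ) := by
  have h1 : MvPolynomial.aeval (fun i => (p i : ℂ)) f = (MvPolynomial.eval p f : ℝ) :=
    (MvPolynomial.hom_eval₂ f (RingHom.id ℝ) Complex.ofRealHom p).symm
  rw [← h1, MvPolynomial.aeval_def, MvPolynomial.aeval_def, MvPolynomial.eval₂_eq,
    MvPolynomial.eval₂_eq, Finset.mul_sum]
  refine Finset.sum_congr rfl fun m hm => ?_
  have hm' : ∑ i ∈ m.support, m i = d := by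
    by_contra h
    exact MvPolynomial.mem_support_iff.1 hm (hf.coeff_eq_zero h)
  simp only [Pi.smul_apply, smul_eq_mul, mul_pow, Finset.prod_mul_distrib,
    Finset.prod_pow_eq_pow_sum, hm']
  ring

theorem affinePoint_mem_dualVariety_or {A : Matrix (Fin n) (Fin n) ℂ}
    (hA : ¬ IsPowerOfLinearForm (kippenhahnPoly A)) {k : ℕ} {a b : ℝ}
    (h : (a + b * Complex.I : ℂ) ∈ frontier (higherRankNumericalRange k A)) :
    affinePoint a b ∈ dualVariety (kippenhahnPoly A) ∨
      ∃ p ∈ singularPoints (kippenhahnPoly A), ((a : ℂ), (b : ℂ)) ∈ dualLine p := by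
  obtain ⟨p, hp0, hline, hf, h1, h2⟩ := exists_tangent_point_squarefreePart h
  obtain ⟨d, -, hd⟩ := exists_isHomogeneous_squarefreePart A hA
  set f := squarefreePart (kippenhahnPoly A) with hfdef
  have hq0 : (fun i => (p i : ℂ)) ≠ 0 := by
    obtain ⟨i, hi⟩ := Function.ne_iff.1 hp0
    exact Function.ne_iff.2 ⟨i, Complex.ofReal_ne_zero.2 hi⟩
  set P : ℙ ℂ (Fin 3 → ℂ) := Projectivization.mk ℂ _ hq0
  obtain ⟨c, hc⟩ := Projectivization.exists_smul_eq_mk_rep ℂ _ hq0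
  have hc' : P.rep = (c : ℂ) • fun i => (p i : ℂ) := hc.symm
  have hzero : MvPolynomial.aeval P.rep f = 0 := by
    rw [hc', aeval_smul_of_isHomogeneous hd, hf, Complex.ofReal_zero, mul_zero]
  have hgrad : gradientAt f P.rep =
      ((c : ℂ) ^ (d - 1) * (MvPolynomial.eval p (MvPolynomial.pderiv 0 f) : ℝ)) •
        ![1, (a : ℂ), (b : ℂ)] := by
    ext i
    rw [gradientAt, hc', aeval_smul_of_isHomogeneous hd.pderiv]
    fin_cases i
    · simp
    · simp [h1]
      ring
    · simp [h2]
      ring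
  -- The gradient is a multiple of `(1, a, b)`: if zero, `P` is singular and `hline` puts `(a, b)`
  -- on its dual line; if not, its class is `[1 : a : b]`.
  by_cases h0 : gradientAt f P.rep = 0
  · right
    refine ⟨P, ⟨hzero, h0⟩, ?_⟩
    have hlineC : (p 0 : ℂ) + a * p 1 + b * p 2 = 0 := by exact_mod_cast hline
    simp only [dualLine, Set.mem_ofPred_eq, hc', Pi.smul_apply, smul_eq_mul]
    linear_combination (c : ℂ) * hlineC
  · left
    refine ⟨P, hzero, h0, ?_⟩
    rw [affinePoint, eq_comm, Projectivization.mk_eq_mk_iff']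
    exact ⟨_, hgrad.symm⟩

theorem exists_isBoundaryPoly (A : Matrix (Fin n) (Fin n) ℂ)
    (hA : ¬ IsPowerOfLinearForm (kippenhahnPoly A)) :
    ∃ g : MvPolynomial (Fin 2) ℝ, IsBoundaryPoly A g := by
  obtain ⟨d, hd2, hd⟩ := exists_isHomogeneous_squarefreePart A hA
  obtain ⟨g, hg⟩ := exists_radical_span_singleton_eq
    (lineDiscriminant (squarefreePart (kippenhahnPoly A)) d)
  exact ⟨g, (radical_comap_saturation_eq hd hd2).trans hg⟩

end Kippenhahn
end

open Kippenhahn in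
theorem mainTheorem6 {n : ℕ} (A : Matrix (Fin n) (Fin n) ℂ)
    (hA : ¬ IsPowerOfLinearForm (kippenhahnPoly A)) :
    (∃ g : MvPolynomial (Fin 2) ℝ, IsBoundaryPoly A g) ∧
    (∀ g : MvPolynomial (Fin 2) ℝ, IsBoundaryPoly A g →
      ∀ k : ℕ, 1 ≤ k → k ≤ n → ∀ a b : ℝ,
        (a + b * Complex.I : ℂ) ∈ frontier (higherRankNumericalRange k A) →
          MvPolynomial.eval ![a, b] g = 0) ∧
    (∀ k : ℕ, 1 ≤ k → k ≤ n → ∀ a b : ℝ,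
      (a + b * Complex.I : ℂ) ∈ frontier (higherRankNumericalRange k A) →
        affinePoint a b ∈ dualVariety (kippenhahnPoly A) ∨
          ∃ p ∈ singularPoints (kippenhahnPoly A), ((a : ℂ), (b : ℂ)) ∈ dualLine p) := by
  refine ⟨exists_isBoundaryPoly A hA, fun g hg k _ _ a b h => ?_,
    fun k _ _ a b h => affinePoint_mem_dualVariety_or hA h⟩
  refine eval_eq_zero_of_mem_boundaryIdeal h ?_
  rw [show boundaryIdeal A = Ideal.span {g} from hg]
  exact Ideal.mem_span_singleton_self g
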